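/- Let $\mathbb{F}_q$ be a finite field with $q$ elements. For an $\mathbb{F}_q$-algebra automorphism $\varphi$ of the polynomial algebra $\mathbb{F}_q[x,y]$ put $f=\varphi(x)$, $g=\varphi(y)$ and $\deg\varphi=\max\{\deg f,\deg g\}$, where $\deg$ denotes the total degree. For $n\ge 1$ let $p_n$ be the number of $\mathbb{F}_q$-algebra automorphisms of $\mathbb{F}_q[x,y]$ of degree $n$. Then for every integer $n\ge 2$ $$(q-1)^3(q+1)^2q^{n+1}\le p_n\le (q-1)^3(q+1)^2q^{n+1}+(\log_2 n)^{\log_2 n}\,q^{n/2+8}.$$ Moreover, for fixed $q$ and every $\varepsilon>0$, $$p_n=(q-1)^3(q+1)^2q^{n+1}+\mathcal{O}\bigl(q^{n(1/2+\varepsilon)}\bigr)\qquad(n\to\infty).$$ -/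

import Mathlib

/-- The group of `K`-algebra automorphisms of the polynomial algebra `K[x, y]`; here `x` is
`MvPolynomial.X 0` and `y` is `MvPolynomial.X 1`. -/
abbrev PlaneAut (K : Type*) [Field K] : Type _ :=
  MvPolynomial (Fin 2) K ≃ₐ[K] MvPolynomial (Fin 2) K

/-- The degree of an automorphism `φ = (f, g)`, `f = φ x`, `g = φ y`: the maximum of the total
degrees of `f` and `g`. -/
noncomputable def PlaneAut.degree {K : Type*} [Field K] (φ : PlaneAut K) : ℕ :=
  max (φ (MvPolynomial.X 0)).totalDegree (φ (MvPolynomial.X 1)).totalDegree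

/-- The number `p_n` of automorphisms of degree `n` of `K[x, y]`. Over a finite field `K` the set
counted is finite, because an automorphism is determined by the pair `(f, g)`. -/
noncomputable def numPlaneAut (K : Type*) [Field K] (n : ℕ) : ℕ :=
  Nat.card {φ : PlaneAut K // φ.degree = n}

/-!
An automorphism of `K[x, y]` is a pair `(f, g)`. The structural input is the reduction step of the
Jung–van der Kulk theorem, `PlaneAut.exists_totalDegree_sub_lt`, valid in every characteristic: if
`deg f ≤ deg g` and `deg g ≥ 2`, then `deg f ∣ deg g`, and some `g - c f ^ k` has smaller degree
than `g`.

For its proof, give `u` and `v` the weights `a = deg f` and `b = deg g`, and let `R(u, v)` be the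
polynomial with `R(f, g) = x` (or the one with `R(f, g) = y`). Its weighted degree exceeds
`deg x = 1`, so its leading form `r` vanishes at the leading forms of `f` and `g`. Being weighted
homogeneous, `r` is then divisible by a binomial `u ^ m - c v ^ n` with `m, n` coprime and
`a m = b n`, and the leading forms satisfy the relation `f ^ m = c g ^ n`
(`exists_dvd_of_aeval_eq_zero`). On the other hand the translation `y ↦ y + s`, written in the
coordinates `f, g`, is a deformation `u ↦ U(s)`, `v ↦ V(s)` that fixes `R`
(`PlaneAut.exists_deformation`). For a suitable weight of `s` the leading forms `F, G` of `U, V`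
still involve `s` (`exists_weight_leadingForm`) and fix `r`, so by degree in `s` they fix the
factor `u ^ m - c v ^ n`. This forces `m = 1` or `n = 1`, hence `n = 1` as `a ≤ b`
(`degreeOf_eq_zero_of_pow_sub_pow`): if the characteristic divides `m` or `n`, a partial
derivative of `F ^ m - c G ^ n = u ^ m - c v ^ n` shows that `F, G` are free of `s`; otherwise
this is the polynomial Fermat–Catalan theorem.

The reduction step turns into counting: for `n ≥ max a 2`, the number of pairs with `deg f = a` and
`deg g < n + 1` is `q` times the number of pairs with `deg f = a` and `deg g < n` when `a ∣ n`, and equal to it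
otherwise (`PlaneAut.card_bounded`). Hence `p_n = (q + 1) L(n)`, where `L(n)` counts the pairs
with `deg f = n > deg g`, and `L(n)` is `(q - 1) ^ 3 (q + 1) q ^ (n + 1) +
∑ (q - 1) q ^ (n / a - 1) L(a)`, summed over the divisors `1 < a < n` of `n` (`PlaneAut.card_bounded_self_recursion`).
The first term, which comes from `deg f = 1` and the order of the affine group, gives the main
term of `p_n`; the others are bounded by the number of ordered factorizations of `n` times
`q ^ (n / 2 + 8)`.
-/

open MvPolynomial

universe u

/-! ### The equation `f ^ m - c g ^ n = u ^ m - c v ^ n` -/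

/-- The curve `x ^ m - c y ^ n = z` has no nonconstant polynomial parametrization when `m, n ≥ 2`
are coprime and prime to the characteristic; a case of the polynomial generalized Fermat equation.
-/
theorem Polynomial.natDegree_eq_zero_of_pow_sub_pow_eq_C {L : Type*} [Field L] {m n : ℕ}
    (hm : 2 ≤ m) (hn : 2 ≤ n) (hmn : m.Coprime n) (hmL : (m : L) ≠ 0) (hnL : (n : L) ≠ 0)
    {c z : L} (hc : c ≠ 0) (hz : z ≠ 0) {f g : Polynomial L}
    (h : f ^ m - Polynomial.C c * g ^ n = Polynomial.C z) :
    f.natDegree = 0 ∧ g.natDegree = 0 := by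
  have hz' : Polynomial.C z ≠ 0 := Polynomial.C_ne_zero.mpr hz
  have hinv : Polynomial.C z⁻¹ * Polynomial.C z = 1 := by
    rw [← Polynomial.C_mul, inv_mul_cancel₀ hz, Polynomial.C_1]
  rcases eq_or_ne f 0 with rfl | hf
  · refine ⟨by simp, ?_⟩
    rw [zero_pow (by omega), zero_sub] at h
    have h2 := congrArg Polynomial.natDegree h
    rw [Polynomial.natDegree_neg, Polynomial.natDegree_C_mul hc, Polynomial.natDegree_pow,
      Polynomial.natDegree_C] at h2
    rcases Nat.mul_eq_zero.mp h2 with h3 | h3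
    · omega
    · exact h3
  rcases eq_or_ne g 0 with rfl | hg
  · refine ⟨?_, by simp⟩
    rw [zero_pow (by omega), mul_zero, sub_zero] at h
    have h2 := congrArg Polynomial.natDegree h
    rw [Polynomial.natDegree_pow, Polynomial.natDegree_C] at h2
    rcases Nat.mul_eq_zero.mp h2 with h3 | h3
    · omega
    · exact h3
  have hcop : IsCoprime f g := by
    refine ⟨Polynomial.C z⁻¹ * f ^ (m - 1), - (Polynomial.C z⁻¹ * Polynomial.C c * g ^ (n - 1)), ?_⟩
    have e1 : f ^ (m - 1) * f = f ^ m := by rw [← pow_succ]; congr 1; omega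
    have e2 : g ^ (n - 1) * g = g ^ n := by rw [← pow_succ]; congr 1; omega
    calc _ = Polynomial.C z⁻¹ * (f ^ (m - 1) * f - Polynomial.C c * (g ^ (n - 1) * g)) := by ring
      _ = 1 := by rw [e1, e2, h, hinv]
  have hne : m ≠ n := by
    rintro rfl
    rw [Nat.coprime_self] at hmn
    omega
  have hlt : m + n + 1 ≤ m * n := by
    rcases Nat.lt_or_gt_of_ne hne with hlt | hlt <;> nlinarith
  -- The third term is the constant `1`, whose exponent is free; `m * n` is large enough for the
  -- exponent inequality and prime to the characteristic.
  have key := Polynomial.flt_catalan (k := L) (p := m) (q := n) (r := m * n) (a := f) (b := g)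
    (c := 1) (u := 1) (v := -c) (w := -z) (by omega) (by omega) (by positivity)
    (by nlinarith [Nat.mul_le_mul_left (m * n) hlt]) hmL hnL
    (by push_cast; exact mul_ne_zero hmL hnL) hf hg one_ne_zero hcop one_ne_zero
    (neg_ne_zero.mpr hc) (neg_ne_zero.mpr hz)
    (by rw [Polynomial.C_neg, Polynomial.C_neg, Polynomial.C_1, one_pow, ← h]; ring)
  exact ⟨key.1, key.2.1⟩

theorem MvPolynomial.degreeOf_eq_zero_of_mul {σ K : Type*} [Field K] {i : σ}
    {p q r : MvPolynomial σ K} (h : p * q = r) (hr : r ≠ 0) (hr0 : degreeOf i r = 0) :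
    degreeOf i p = 0 := by
  have hp : p ≠ 0 := by rintro rfl; simp at h; exact hr h.symm
  have hq : q ≠ 0 := by rintro rfl; simp at h; exact hr h.symm
  rw [← h, degreeOf_mul_eq hp hq] at hr0
  omega

theorem MvPolynomial.degreeOf_eq_zero_of_pow {σ K : Type*} [Field K] {i : σ} {n : ℕ} (hn : n ≠ 0)
    {p : MvPolynomial σ K} (h : degreeOf i (p ^ n) = 0) : degreeOf i p = 0 := by
  rcases eq_or_ne p 0 with rfl | hp
  · simp
  · rw [degreeOf_pow_eq _ _ _ hp] at h
    rcases Nat.mul_eq_zero.mp h with h3 | h3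
    · omega
    · exact h3

theorem MvPolynomial.degreeOf_C_mul_pow_X {σ K : Type*} [Field K] {i j : σ} (hij : i ≠ j)
    (c : K) (n : ℕ) : degreeOf i (C c * (X j : MvPolynomial σ K) ^ n) = 0 := by
  classical
  have h := (degreeOf_C_mul_le (X j ^ n : MvPolynomial σ K) i c).trans (degreeOf_pow_le i (X j) n)
  rw [degreeOf_X, if_neg hij] at h
  omega

/-- When the characteristic divides `m`, the partial derivative in the `j`-th variable of
`α f ^ m + β g ^ n = α x_i ^ m + β x_j ^ n` reads `g ^ (n - 1) * ∂g = x_j ^ (n - 1)`, so `g` is free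
of the variable `s`, and then so is `f`. -/
theorem degreeOf_eq_zero_of_natCast_eq_zero {σ K : Type*} [Field K] {s i j : σ} (hsi : s ≠ i)
    (hsj : s ≠ j) (hij : i ≠ j) {m n : ℕ} (hm : m ≠ 0) (hn : 2 ≤ n) (hmK : (m : K) = 0)
    (hnK : (n : K) ≠ 0) {α β : K} (hα : α ≠ 0) (hβ : β ≠ 0) {f g : MvPolynomial σ K}
    (h : C α * f ^ m + C β * g ^ n = C α * X i ^ m + C β * X j ^ n) :
    degreeOf s f = 0 ∧ degreeOf s g = 0 := by
  classical
  have hcast : ((m : ℕ) : MvPolynomial σ K) = 0 := by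
    rw [← map_natCast (C : K →+* MvPolynomial σ K) m, hmK, map_zero]
  have hd := congrArg (pderiv j) h
  simp only [map_add, Derivation.leibniz, Derivation.leibniz_pow, pderiv_C, smul_zero, add_zero,
    pderiv_X_self, pderiv_X_of_ne hij, hcast, nsmul_eq_mul, smul_eq_mul, zero_mul, mul_zero,
    zero_add, mul_one] at hd
  have hncast : ((n : ℕ) : MvPolynomial σ K) ≠ 0 := by
    rw [← map_natCast (C : K →+* MvPolynomial σ K) n]
    exact (C_ne_zero).mpr hnK
  have hd2 : g ^ (n - 1) * pderiv j g = X j ^ (n - 1) :=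
    mul_left_cancel₀ hncast (mul_left_cancel₀ (C_ne_zero.mpr hβ) hd)
  have hX : ∀ k, degreeOf s ((X j : MvPolynomial σ K) ^ k) = 0 := by
    intro k
    simpa using degreeOf_C_mul_pow_X (K := K) hsj 1 k
  have hg : degreeOf s g = 0 := degreeOf_eq_zero_of_pow (n := n - 1) (by omega)
    (degreeOf_eq_zero_of_mul hd2 (pow_ne_zero _ (X_ne_zero j)) (hX _))
  refine ⟨?_, hg⟩
  have hf : C α * f ^ m = C α * X i ^ m + C β * X j ^ n - C β * g ^ n := by rw [← h]; ring
  have h0 : degreeOf s (C α * f ^ m) = 0 := by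
    rw [hf]
    have e1 := degreeOf_C_mul_pow_X (K := K) hsi α m
    have e2 := degreeOf_C_mul_pow_X (K := K) hsj β n
    have e3 := (degreeOf_C_mul_le (g ^ n) s β).trans (degreeOf_pow_le s g n)
    rw [hg, mul_zero] at e3
    have e4 := degreeOf_sub_le s (C α * X i ^ m + C β * X j ^ n) (C β * g ^ n)
    have e5 := degreeOf_add_le s (C α * (X i : MvPolynomial σ K) ^ m) (C β * X j ^ n)
    omega
  rcases eq_or_ne f 0 with rfl | hf0
  · simp
  · exact degreeOf_eq_zero_of_pow hm (degreeOf_eq_zero_of_mul (by rw [mul_comm] : f ^ m * C α = _)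
      (mul_ne_zero (C_ne_zero.mpr hα) (pow_ne_zero _ hf0)) h0)

/-- A solution in `K[s, u, v]` of `f ^ m - c g ^ n = u ^ m - c v ^ n`, with `m, n ≥ 2` coprime,
does not involve `s`. If the characteristic divides `m` or `n`, differentiate; otherwise regard `f`
and `g` as polynomials in `s` over the field `K(u, v)`. -/
theorem degreeOf_eq_zero_of_pow_sub_pow {K : Type*} [Field K] {m n : ℕ}
    (hm : 2 ≤ m) (hn : 2 ≤ n) (hmn : m.Coprime n) {c : K} (hc : c ≠ 0)
    {f g : MvPolynomial (Fin 3) K} (h : f ^ m - C c * g ^ n = X 1 ^ m - C c * X 2 ^ n) :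
    degreeOf 0 f = 0 ∧ degreeOf 0 g = 0 := by
  have h' : C 1 * f ^ m + C (-c) * g ^ n = C 1 * X 1 ^ m + C (-c) * X 2 ^ n := by
    rw [C_neg, C_1]; linear_combination h
  by_cases hmK : (m : K) = 0
  · have hnK : (n : K) ≠ 0 := by
      intro hnK
      rw [ringChar.spec] at hmK hnK
      have h1 := Nat.dvd_gcd hmK hnK
      rw [hmn, Nat.dvd_one] at h1
      rw [h1] at hmK
      have := (ringChar.spec K 1).mpr (by rw [h1])
      simp at this
    exact degreeOf_eq_zero_of_natCast_eq_zero (s := (0 : Fin 3)) (i := 1) (j := 2) (by decide)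
      (by decide)
      (by decide) (by omega) hn hmK hnK
      one_ne_zero (neg_ne_zero.mpr hc) h'
  by_cases hnK : (n : K) = 0
  · exact (degreeOf_eq_zero_of_natCast_eq_zero (s := (0 : Fin 3)) (i := 2) (j := 1) (by decide)
      (by decide)
      (by decide) (by omega) hm hnK hmK
      (neg_ne_zero.mpr hc) one_ne_zero (by rw [add_comm, h', add_comm])).symm
  let L := FractionRing (MvPolynomial (Fin 2) K)
  let ι : MvPolynomial (Fin 2) K →+* L := algebraMap _ _
  have hι : Function.Injective ι := IsFractionRing.injective _ _
  have hιK : ∀ k : ℕ, (k : K) ≠ 0 → (k : L) ≠ 0 := by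
    intro k hk hkL
    have : ι (C (k : K)) = 0 := by simpa using hkL
    rw [map_eq_zero_iff ι hι] at this
    exact C_ne_zero.mpr hk this
  have h2 := congrArg (fun p => Polynomial.map ι (finSuccEquiv K 2 p)) h
  have hX1 : finSuccEquiv K 2 (X 1) = Polynomial.C (X 0) := finSuccEquiv_X_succ (j := 0)
  have hX2 : finSuccEquiv K 2 (X 2) = Polynomial.C (X 1) := finSuccEquiv_X_succ (j := 1)
  have hCc : finSuccEquiv K 2 (C c) = Polynomial.C (C c) := by
    simp [finSuccEquiv_apply]
  simp only [map_sub, map_mul, map_pow, Polynomial.map_sub, Polynomial.map_mul,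
    Polynomial.map_pow, hX1, hX2, hCc, Polynomial.map_C] at h2
  have hz : (X 0 ^ m - C c * X 1 ^ n : MvPolynomial (Fin 2) K) ≠ 0 := by
    intro h0
    have := congrArg (aeval ![(1 : K), 0]) h0
    simp [show n ≠ 0 by omega] at this
  have := Polynomial.natDegree_eq_zero_of_pow_sub_pow_eq_C (L := L) hm hn hmn (hιK m hmK)
    (hιK n hnK) (c := ι (C c)) (z := ι (X 0 ^ m - C c * X 1 ^ n))
    ((map_ne_zero_iff ι hι).mpr (C_ne_zero.mpr hc)) ((map_ne_zero_iff ι hι).mpr hz)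
    (f := Polynomial.map ι (finSuccEquiv K 2 f)) (g := Polynomial.map ι (finSuccEquiv K 2 g))
    (by rw [h2]; simp)
  rwa [Polynomial.natDegree_map_eq_of_injective hι, Polynomial.natDegree_map_eq_of_injective hι,
    natDegree_finSuccEquiv, natDegree_finSuccEquiv] at this

/-! ### Leading forms -/

/-- All monomials of `p` have `w`-weight at most `d`, and `q` is the part of `p` of weight exactly
`d`. The form `q` may vanish, so `d` is only an upper bound for the weighted degree of `p`. Weights
are rational, possibly negative. -/
def HasLeadingForm {σ K : Type*} [Field K] (w : σ → ℚ) (d : ℚ) (p q : MvPolynomial σ K) : Prop :=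
  (∀ e ∈ p.support, Finsupp.weight w e ≤ d) ∧ weightedHomogeneousComponent w d p = q

namespace HasLeadingForm
variable {σ K : Type*} [Field K] {w : σ → ℚ} {d d' : ℚ} {p p' q q' : MvPolynomial σ K}

theorem zero (w : σ → ℚ) (d : ℚ) : HasLeadingForm w d (0 : MvPolynomial σ K) 0 := by
  constructor <;> simp

theorem add (h : HasLeadingForm w d p q) (h' : HasLeadingForm w d p' q') :
    HasLeadingForm w d (p + p') (q + q') := by
  classical
  refine ⟨fun e he => ?_, by rw [map_add, h.2, h'.2]⟩
  rcases Finset.mem_union.mp (support_add he) with h1 | h1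
  · exact h.1 e h1
  · exact h'.1 e h1

theorem sum {ι : Type*} (s : Finset ι) {f g : ι → MvPolynomial σ K}
    (h : ∀ i ∈ s, HasLeadingForm w d (f i) (g i)) :
    HasLeadingForm w d (∑ i ∈ s, f i) (∑ i ∈ s, g i) := by
  classical
  induction s using Finset.induction_on with
  | empty => simpa using zero w d
  | insert a s ha ih =>
    rw [Finset.sum_insert ha, Finset.sum_insert ha]
    exact (h a (by simp)).add (ih fun i hi => h i (by simp [hi]))

theorem mul (h : HasLeadingForm w d p q) (h' : HasLeadingForm w d' p' q') :
    HasLeadingForm w (d + d') (p * p') (q * q') := by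
  classical
  refine ⟨fun e he => ?_, ?_⟩
  · obtain ⟨x, hx, y, hy, rfl⟩ := Finset.mem_add.mp (support_mul p p' he)
    rw [map_add]
    exact add_le_add (h.1 x hx) (h'.1 y hy)
  · ext e
    rw [coeff_weightedHomogeneousComponent, ← h.2, ← h'.2, coeff_mul, coeff_mul]
    split_ifs with hw
    · refine Finset.sum_congr rfl fun x hx => ?_
      rw [coeff_weightedHomogeneousComponent, coeff_weightedHomogeneousComponent]
      rw [Finset.HasAntidiagonal.mem_antidiagonal] at hx
      rw [← hx, map_add] at hw
      by_cases h0 : coeff x.1 p = 0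
      · simp [h0]
      by_cases h0' : coeff x.2 p' = 0
      · simp [h0']
      have e1 := h.1 _ (mem_support_iff.mpr h0)
      have e2 := h'.1 _ (mem_support_iff.mpr h0')
      rw [if_pos (by linarith), if_pos (by linarith)]
    · refine (Finset.sum_eq_zero fun x hx => ?_).symm
      rw [coeff_weightedHomogeneousComponent, coeff_weightedHomogeneousComponent]
      rw [Finset.HasAntidiagonal.mem_antidiagonal] at hx
      rw [← hx, map_add] at hw
      split_ifs with e1 e2
      · exact absurd (by rw [e1, e2]) hw
      all_goals simp

theorem const (w : σ → ℚ) (c : K) : HasLeadingForm w 0 (C c) (C c) := by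
  classical
  refine ⟨fun e he => ?_, ?_⟩
  · rw [mem_support_iff, coeff_C] at he
    have : e = 0 := by
      by_contra h
      exact he (if_neg (Ne.symm h))
    simp [this]
  · exact (isWeightedHomogeneous_C w c).weightedHomogeneousComponent_same

theorem pow (h : HasLeadingForm w d p q) (n : ℕ) : HasLeadingForm w (n • d) (p ^ n) (q ^ n) := by
  induction n with
  | zero => simpa using const w (1 : K)
  | succ n ih => rw [pow_succ, pow_succ, succ_nsmul]; exact ih.mul h

theorem prod {ι : Type*} (s : Finset ι) {f g : ι → MvPolynomial σ K} {D : ι → ℚ}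
    (h : ∀ i ∈ s, HasLeadingForm w (D i) (f i) (g i)) :
    HasLeadingForm w (∑ i ∈ s, D i) (∏ i ∈ s, f i) (∏ i ∈ s, g i) := by
  classical
  induction s using Finset.induction_on with
  | empty => simpa using const w (1 : K)
  | insert a s ha ih =>
    rw [Finset.prod_insert ha, Finset.prod_insert ha, Finset.sum_insert ha]
    exact (h a (by simp)).mul (ih fun i hi => h i (by simp [hi]))

theorem of_lt (h : HasLeadingForm w d p q) (hd : d < d') : HasLeadingForm w d' p 0 := by
  classical
  refine ⟨fun e he => (h.1 e he).trans hd.le, ?_⟩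
  ext e
  rw [coeff_weightedHomogeneousComponent, coeff_zero]
  split_ifs with hw
  · by_contra h0
    exact absurd (h.1 e (mem_support_iff.mpr h0)) (by rw [hw]; exact not_le.mpr hd)
  · rfl

/-- Leading forms are compatible with substitution, when the variable `i` of the outer polynomial
is given as weight the bound `v i` for the polynomial substituted for it. -/
theorem aeval {τ : Type*} {v : τ → ℚ} {f g : τ → MvPolynomial σ K}
    (hfg : ∀ i, HasLeadingForm w (v i) (f i) (g i)) {N : ℚ} {r t : MvPolynomial τ K}
    (h : HasLeadingForm v N r t) :
    HasLeadingForm w N (MvPolynomial.aeval f r) (MvPolynomial.aeval g t) := by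
  classical
  have ht : t = ∑ e ∈ r.support, weightedHomogeneousComponent v N (monomial e (coeff e r)) := by
    rw [← map_sum, ← as_sum, h.2]
  rw [ht]
  conv_lhs => rw [r.as_sum]
  rw [map_sum, map_sum]
  refine sum _ fun e he => ?_
  have hle := h.1 e he
  have hm : HasLeadingForm w (Finsupp.weight v e) (MvPolynomial.aeval f (monomial e (coeff e r)))
      (MvPolynomial.aeval g (monomial e (coeff e r))) := by
    rw [aeval_monomial, aeval_monomial, Finsupp.prod, Finsupp.prod, Finsupp.weight_apply,
      Finsupp.sum, ← zero_add (∑ i ∈ e.support, e i • v i)]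
    exact (const w _).mul (prod _ fun i _ => (hfg i).pow (e i))
  rcases hle.lt_or_eq with hlt | heq
  · rw [weightedHomogeneousComponent_of_mem (n := Finsupp.weight v e)
      (isWeightedHomogeneous_monomial _ _ _ rfl), if_neg hlt.ne', map_zero]
    exact hm.of_lt hlt
  · rw [weightedHomogeneousComponent_of_mem (n := Finsupp.weight v e)
      (isWeightedHomogeneous_monomial _ _ _ rfl), if_pos heq.symm, ← heq]
    exact hm

end HasLeadingForm

/-! ### Weighted homogeneous relations between two polynomials -/

theorem MvPolynomial.algHom_aeval_pair {K A B : Type*} [CommSemiring K] [CommSemiring A]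
    [CommSemiring B] [Algebra K A] [Algebra K B] (φ : A →ₐ[K] B) (f g : A)
    (r : MvPolynomial (Fin 2) K) : φ (aeval ![f, g] r) = aeval ![φ f, φ g] r := by
  rw [comp_aeval_apply]
  congr 2
  ext i
  fin_cases i <;> rfl

/-- A polynomial `r(u, v)` homogeneous for the weights `a, b` is, up to a monomial, a
one-variable polynomial `S` in `u ^ b / v ^ a`. The identity is stated without division, in every
commutative algebra and for every `ρ` playing the role of the quotient. -/
theorem exists_polynomial_aeval_eq {K : Type u} [Field K] {a b : ℕ} (hb : 0 < b)
    (hab : a.Coprime b) {r : MvPolynomial (Fin 2) K} (hr : r ≠ 0)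
    (hom : ∀ e ∈ r.support, ∀ e' ∈ r.support, a * e 0 + b * e 1 = a * e' 0 + b * e' 1) :
    ∃ (S : Polynomial K) (i j : ℕ), S ≠ 0 ∧ ∀ (T : Type u) [CommRing T] [Algebra K T]
      (α β ρ : T), α ^ b = ρ * β ^ a →
        aeval ![α, β] r = Polynomial.aeval ρ S * (α ^ i * β ^ j) := by
  classical
  obtain ⟨m, hm, hmin⟩ := Finset.exists_min_image r.support (fun e => e 0)
    (support_nonempty.mpr hr)
  -- With `m` the exponent of least first coordinate, the exponents are `m + k (b, -a)`, `k ≥ 0`.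
  have key : ∀ e ∈ r.support, e 0 = m 0 + b * ((e 0 - m 0) / b) ∧
      m 1 = e 1 + a * ((e 0 - m 0) / b) := by
    intro e he
    have h1 := hmin e he
    have h2 := hom e he m hm
    obtain ⟨t, ht⟩ := Nat.exists_eq_add_of_le h1
    rw [ht, mul_add] at h2
    have hle : e 1 ≤ m 1 := by
      have : b * e 1 ≤ b * m 1 := by omega
      exact Nat.le_of_mul_le_mul_left this hb
    obtain ⟨l, hl⟩ := Nat.exists_eq_add_of_le hle
    rw [hl, mul_add] at h2
    have h3 : a * t = b * l := by omega
    obtain ⟨k, rfl⟩ : b ∣ t := hab.symm.dvd_of_dvd_mul_left ⟨l, h3⟩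
    have h4 : l = a * k := by
      have : b * l = b * (a * k) := by rw [← h3]; ring
      exact Nat.eq_of_mul_eq_mul_left hb this
    rw [ht, hl, h4, Nat.add_sub_cancel_left, Nat.mul_div_cancel_left _ hb]
    exact ⟨rfl, rfl⟩
  refine ⟨∑ e ∈ r.support, Polynomial.monomial ((e 0 - m 0) / b) (coeff e r), m 0, m 1, ?_, ?_⟩
  · intro h0
    have h1 := congrArg (fun p => Polynomial.coeff p 0) h0
    simp only [Polynomial.finsetSum_coeff, Polynomial.coeff_monomial, Polynomial.coeff_zero] at h1
    rw [Finset.sum_eq_single m] at h1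
    · simp only [tsub_self, Nat.zero_div, if_true] at h1
      exact mem_support_iff.mp hm h1
    · intro e he hne
      rw [if_neg]
      intro hk
      obtain ⟨k1, k2⟩ := key e he
      rw [hk] at k1 k2
      apply hne
      ext i
      fin_cases i
      · simpa using k1
      · simpa using k2.symm
    · intro h; exact absurd hm h
  · intro T _ _ α β ρ h
    conv_lhs => rw [r.as_sum]
    rw [map_sum, map_sum, Finset.sum_mul]
    refine Finset.sum_congr rfl fun e he => ?_
    obtain ⟨k1, k2⟩ := key e he
    rw [aeval_monomial, Finsupp.prod_fintype _ _ (by simp), Fin.prod_univ_two,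
      Polynomial.aeval_monomial, mul_assoc]
    simp only [Matrix.cons_val_zero, Matrix.cons_val_one]
    congr 1
    set k := (e 0 - m 0) / b
    rw [k1, k2, pow_add, pow_add, pow_mul, pow_mul, h, mul_pow]
    ring

/-- The field `K` is algebraically closed in the field of rational functions: an
algebraic element and its inverse are integral over the normal ring of polynomials. -/
theorem MvPolynomial.exists_eq_algebraMap_of_isAlgebraic {σ K : Type*} [Field K]
    {x : FractionRing (MvPolynomial σ K)} (hx : IsAlgebraic K x) :
    ∃ c : K, x = algebraMap (MvPolynomial σ K) _ (C c) := by
  rcases eq_or_ne x 0 with rfl | h0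
  · exact ⟨0, by simp⟩
  have hint : ∀ y : FractionRing (MvPolynomial σ K), IsAlgebraic K y →
      ∃ p : MvPolynomial σ K, algebraMap _ _ p = y := fun y hy =>
    IsIntegrallyClosed.algebraMap_eq_of_integral (hy.isIntegral.tower_top)
  obtain ⟨p, hp⟩ := hint x hx
  obtain ⟨q, hq⟩ := hint x⁻¹ hx.inv
  have hpq : p * q = 1 := by
    apply IsFractionRing.injective (MvPolynomial σ K) (FractionRing (MvPolynomial σ K))
    rw [map_mul, hp, hq, mul_inv_cancel₀ h0, map_one]
  obtain ⟨c, -, hc⟩ := isUnit_iff_eq_C_of_isReduced.mp (IsUnit.of_mul_eq_one q hpq)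
  exact ⟨c, by rw [← hp, hc]⟩

/-- If nonzero `f, g` satisfy a weighted homogeneous relation `r(f, g) = 0` with coprime
weights `a, b`, then `f ^ b = c g ^ a` for a scalar `c`, and `r` is divisible by the corresponding
binomial. Only the homogeneity of `r` matters, not that of `f` and `g`. -/
theorem exists_dvd_of_aeval_eq_zero {K : Type u} [Field K] {a b : ℕ} (hb : 0 < b)
    (hab : a.Coprime b) {r : MvPolynomial (Fin 2) K} (hr : r ≠ 0)
    (hom : ∀ e ∈ r.support, ∀ e' ∈ r.support, a * e 0 + b * e 1 = a * e' 0 + b * e' 1)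
    {f g : MvPolynomial (Fin 2) K} (hf : f ≠ 0) (hg : g ≠ 0) (h : aeval ![f, g] r = 0) :
    ∃ c : K, c ≠ 0 ∧ f ^ b = C c * g ^ a ∧ X 0 ^ b - C c * X 1 ^ a ∣ r := by
  obtain ⟨S, i, j, hS, H⟩ := exists_polynomial_aeval_eq hb hab hr hom
  let ι := algebraMap (MvPolynomial (Fin 2) K) (FractionRing (MvPolynomial (Fin 2) K))
  have hι : Function.Injective ι := IsFractionRing.injective _ _
  have hιf : ι f ≠ 0 := (map_ne_zero_iff ι hι).mpr hf
  have hιg : ι g ≠ 0 := (map_ne_zero_iff ι hι).mpr hg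
  have h1 := H _ (ι f) (ι g) (ι f ^ b / ι g ^ a) (by field_simp)
  have h2 : aeval ![ι f, ι g] r = 0 := by
    have := algHom_aeval_pair (IsScalarTower.toAlgHom K (MvPolynomial (Fin 2) K)
      (FractionRing (MvPolynomial (Fin 2) K))) f g r
    rw [h, map_zero] at this
    exact this.symm
  rw [h2] at h1
  have h3 := (mul_eq_zero.mp h1.symm).resolve_right
    (mul_ne_zero (pow_ne_zero _ hιf) (pow_ne_zero _ hιg))
  obtain ⟨c, hc⟩ := exists_eq_algebraMap_of_isAlgebraic ⟨S, hS, h3⟩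
  have hfg : f ^ b = C c * g ^ a := by
    apply hι
    rw [map_mul, map_pow, map_pow]
    rw [div_eq_iff (pow_ne_zero _ hιg)] at hc
    exact hc
  refine ⟨c, ?_, hfg, ?_⟩
  · rintro rfl
    rw [C_0, zero_mul] at hfg
    exact pow_ne_zero _ hf hfg
  · have hSc : Polynomial.aeval c S = 0 := by
      have : algebraMap K (FractionRing (MvPolynomial (Fin 2) K)) (Polynomial.aeval c S) = 0 := by
        rw [← Polynomial.aeval_algebraMap_apply, ← h3, hc]; rfl
      exact (map_eq_zero _).mp this
    rw [← Ideal.mem_span_singleton, ← Ideal.Quotient.eq_zero_iff_mem]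
    -- Modulo the binomial, `u ^ b = c v ^ a`, so `r` reduces to a multiple of `S(c) = 0`.
    set I := Ideal.span {(X 0 ^ b - C c * X 1 ^ a : MvPolynomial (Fin 2) K)}
    have h4 := H (MvPolynomial (Fin 2) K ⧸ I) (Ideal.Quotient.mk I (X 0))
      (Ideal.Quotient.mk I (X 1)) (algebraMap K _ c) (by
        have : Ideal.Quotient.mk I (X 0 ^ b - C c * X 1 ^ a) = 0 :=
          Ideal.Quotient.eq_zero_iff_mem.mpr (Ideal.mem_span_singleton_self _)
        rw [map_sub, sub_eq_zero] at this
        rw [map_pow, map_mul, map_pow] at this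
        exact this)
    rw [Polynomial.aeval_algebraMap_apply, hSc, map_zero, zero_mul] at h4
    rw [← h4]
    have h5 := algHom_aeval_pair (Ideal.Quotient.mkₐ K I) (X 0) (X 1) r
    rw [show ![X 0, X 1] = (X : Fin 2 → MvPolynomial (Fin 2) K) from ?_, aeval_X_left_apply] at h5
    · exact h5
    · ext1 i
      fin_cases i <;> rfl

/-! ### Translations in the coordinates of an automorphism -/

theorem MvPolynomial.degreeOf_eq_zero_iff_forall {σ K : Type*} [Field K] (i : σ)
    (p : MvPolynomial σ K) : degreeOf i p = 0 ↔ ∀ m ∈ p.support, m i = 0 := by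
  rw [← Nat.le_zero, degreeOf_le_iff]
  simp

section SetFirstVariableZero
variable {K : Type*} [Field K]

/-- The substitution `s ↦ 0` from `K[s, u, v]` to `K[u, v]`. -/
noncomputable def evalFirstZero (K : Type*) [Field K] :
    MvPolynomial (Fin 3) K →ₐ[K] MvPolynomial (Fin 2) K :=
  aeval ![0, X 0, X 1]

theorem coeff_evalFirstZero (p : MvPolynomial (Fin 3) K) (e : Fin 2 →₀ ℕ) :
    coeff e (evalFirstZero K p) = coeff (e.cons 0) p := by
  rw [← finSuccEquiv_coeff_coeff]
  congr 1
  have : (evalFirstZero K : MvPolynomial (Fin 3) K →+* MvPolynomial (Fin 2) K) =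
      Polynomial.constantCoeff.comp (finSuccEquiv K 2 : MvPolynomial (Fin 3) K →+* _) := by
    apply ringHom_ext
    · intro r
      simp [evalFirstZero, finSuccEquiv_apply, algebraMap_eq]
    · intro i
      refine Fin.cases ?_ (fun i => ?_) i
      · simp [evalFirstZero, finSuccEquiv_X_zero]
      · simp only [RingHom.coe_comp, Function.comp_apply, RingHom.coe_coe, finSuccEquiv_X_succ]
        fin_cases i <;> simp [evalFirstZero]
  exact congrArg (fun φ => φ p) this

theorem evalFirstZero_rename_succ (p : MvPolynomial (Fin 2) K) :
    evalFirstZero K (rename Fin.succ p) = p := by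
  rw [evalFirstZero, aeval_rename]
  conv_rhs => rw [← aeval_X_left_apply (R := K) p]
  congr 2
  ext1 i
  fin_cases i <;> rfl

/-- Polynomials in `K[s, u, v]` not involving `s` are the image of `K[u, v]`. -/
theorem rename_succ_evalFirstZero {p : MvPolynomial (Fin 3) K} (hp : degreeOf 0 p = 0) :
    rename Fin.succ (evalFirstZero K p) = p := by
  have h0 : (0 : Fin 3) ∉ p.vars := by
    classical
    intro h
    obtain ⟨d, hd, hd0⟩ := (mem_vars_iff_mem_support 0).mp h
    exact (Finsupp.mem_support_iff.mp hd0) ((degreeOf_eq_zero_iff_forall 0 p).mp hp d hd)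
  have := hom_congr_vars (R := K) (f₁ := ((rename Fin.succ).comp (evalFirstZero K) :
      MvPolynomial (Fin 3) K →ₐ[K] MvPolynomial (Fin 3) K).toRingHom) (f₂ := RingHom.id _)
    (p₁ := p) (p₂ := p) ?_ ?_ rfl
  · exact this
  · ext r
    simp
  · intro i hi _
    fin_cases i
    · exact absurd hi h0
    · simp [evalFirstZero]
    · simp [evalFirstZero]

theorem degreeOf_zero_rename_succ (p : MvPolynomial (Fin 2) K) :
    degreeOf (0 : Fin 3) (rename Fin.succ p) = 0 := by
  classical
  rw [degreeOf_eq_zero_iff_forall]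
  intro m hm
  obtain ⟨d, hd, -⟩ := coeff_rename_ne_zero Fin.succ p m (mem_support_iff.mp hm)
  rw [← hd]
  exact Finsupp.mapDomain_of_notMem_range _ _ (by simp)

theorem weight_fin_two (a b : ℚ) (e : Fin 2 →₀ ℕ) :
    Finsupp.weight ![a, b] e = e 0 * a + e 1 * b := by
  rw [Finsupp.weight_apply, Finsupp.sum_fintype _ _ (by simp), Fin.sum_univ_two]
  simp

theorem weight_fin_three (s a b : ℚ) (e : Fin 3 →₀ ℕ) :
    Finsupp.weight ![s, a, b] e = e 0 * s + e 1 * a + e 2 * b := by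
  rw [Finsupp.weight_apply, Finsupp.sum_fintype _ _ (by simp), Fin.sum_univ_three]
  simp

theorem evalFirstZero_weightedHomogeneousComponent (s a b N : ℚ) (p : MvPolynomial (Fin 3) K) :
    evalFirstZero K (weightedHomogeneousComponent ![s, a, b] N p) =
      weightedHomogeneousComponent ![a, b] N (evalFirstZero K p) := by
  classical
  ext e
  rw [coeff_evalFirstZero, coeff_weightedHomogeneousComponent, coeff_weightedHomogeneousComponent,
    coeff_evalFirstZero, weight_fin_two, weight_fin_three, Finsupp.cons_zero]
  have h1 : e.cons 0 (1 : Fin 3) = e 0 := Finsupp.cons_succ 0 0 e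
  have h2 : e.cons 0 (2 : Fin 3) = e 1 := Finsupp.cons_succ 1 0 e
  rw [h1, h2]
  simp

end SetFirstVariableZero

theorem hasLeadingForm_X {σ K : Type*} [Field K] (w : σ → ℚ) (i : σ) :
    HasLeadingForm w (w i) (X i : MvPolynomial σ K) (X i) := by
  classical
  refine ⟨fun e he => ?_, (isWeightedHomogeneous_X K w i).weightedHomogeneousComponent_same⟩
  exact ((isWeightedHomogeneous_X K w i) (mem_support_iff.mp he)).le

/-- Given a deformation `(U, V)` of `(u, v)` with parameter `s` that really involves `s`, there is
a weight for `s` such that `U` and `V` keep the weights `a` and `b` of `u` and `v`, while their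
leading forms still involve `s`. -/
theorem exists_weight_leadingForm {K : Type*} [Field K] (a b : ℚ)
    {U V : MvPolynomial (Fin 3) K} (hU : evalFirstZero K U = X 0) (hV : evalFirstZero K V = X 1)
    (hUV : ¬ (degreeOf 0 U = 0 ∧ degreeOf 0 V = 0)) :
    ∃ (s : ℚ) (f g : MvPolynomial (Fin 3) K), HasLeadingForm ![s, a, b] a U f ∧
      HasLeadingForm ![s, a, b] b V g ∧ ¬ (degreeOf 0 f = 0 ∧ degreeOf 0 g = 0) := by
  classical
  -- `slope c e` is the weight of `s` for which the monomial `e` has weight `c`; the weight sought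
  -- is the least slope among the monomials of `U` and `V` that involve `s`.
  let slope : ℚ → (Fin 3 →₀ ℕ) → ℚ := fun c e => (c - e 1 * a - e 2 * b) / e 0
  let A := (U.support.filter fun e => e 0 ≠ 0).image (slope a)
  let B := (V.support.filter fun e => e 0 ≠ 0).image (slope b)
  have hne : (A ∪ B).Nonempty := by
    by_contra h
    rw [Finset.not_nonempty_iff_eq_empty, Finset.union_eq_empty, Finset.image_eq_empty,
      Finset.image_eq_empty, Finset.filter_eq_empty_iff, Finset.filter_eq_empty_iff] at h
    apply hUV
    rw [degreeOf_eq_zero_iff_forall,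
      degreeOf_eq_zero_iff_forall]
    exact ⟨fun m hm => not_not.mp (h.1 hm), fun m hm => not_not.mp (h.2 hm)⟩
  let s := (A ∪ B).min' hne
  have bound : ∀ (W : MvPolynomial (Fin 3) K) (i : Fin 2), evalFirstZero K W = X i →
      (∀ e ∈ W.support, e 0 ≠ 0 → s ≤ slope (![a, b] i) e) →
      ∀ e ∈ W.support, Finsupp.weight ![s, a, b] e ≤ ![a, b] i := by
    intro W i hW hs e he
    rw [weight_fin_three]
    by_cases h0 : e 0 = 0
    · have hc : coeff e.tail (X i : MvPolynomial (Fin 2) K) ≠ 0 := by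
        rw [← hW, coeff_evalFirstZero, ← h0, Finsupp.cons_tail]
        exact mem_support_iff.mp he
      have h3 := (isWeightedHomogeneous_X K ![a, b] i) hc
      rw [weight_fin_two] at h3
      have h1 : e.tail 0 = e 1 := rfl
      have h2 : e.tail 1 = e 2 := rfl
      rw [h1, h2] at h3
      rw [h0, ← h3]
      simp
    · have h1 := hs e he h0
      rw [le_div_iff₀ (by positivity)] at h1
      linarith
  have eqn : ∀ (W : MvPolynomial (Fin 3) K) (c : ℚ) (e : Fin 3 →₀ ℕ), e ∈ W.support → e 0 ≠ 0 →
      slope c e = s → degreeOf 0 (weightedHomogeneousComponent ![s, a, b] c W) ≠ 0 := by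
    intro W c e he h0 hs h
    have hw : Finsupp.weight ![s, a, b] e = c := by
      rw [weight_fin_three, ← hs]
      have : (e 0 : ℚ) ≠ 0 := by positivity
      simp only [slope]
      field_simp
      ring
    rw [degreeOf_eq_zero_iff_forall] at h
    refine h0 (h e (mem_support_iff.mpr ?_))
    rw [coeff_weightedHomogeneousComponent, if_pos hw]
    exact mem_support_iff.mp he
  refine ⟨s, _, _, ⟨bound U 0 hU fun e he h0 => ?_, rfl⟩, ⟨bound V 1 hV fun e he h0 => ?_, rfl⟩, ?_⟩
  · exact Finset.min'_le _ _ (Finset.mem_union_left _ (Finset.mem_image_of_mem _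
      (Finset.mem_filter.mpr ⟨he, h0⟩)))
  · exact Finset.min'_le _ _ (Finset.mem_union_right _ (Finset.mem_image_of_mem _
      (Finset.mem_filter.mpr ⟨he, h0⟩)))
  · rintro ⟨h1, h2⟩
    rcases Finset.mem_union.mp (Finset.min'_mem _ hne) with h | h
    · obtain ⟨e, he, hs⟩ := Finset.mem_image.mp h
      obtain ⟨he, h0⟩ := Finset.mem_filter.mp he
      exact eqn U a e he h0 hs h1
    · obtain ⟨e, he, hs⟩ := Finset.mem_image.mp h
      obtain ⟨he, h0⟩ := Finset.mem_filter.mp he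
      exact eqn V b e he h0 hs h2

/-- The translation `x ↦ x, y ↦ y + s` in the original coordinates, written in the coordinates
`u = φ x`, `v = φ y`: a deformation `(U, V)` of `(u, v)`, not constant in `s`, along which the
coordinate function `x`, that is `φ⁻¹ x` as a polynomial in `u, v`, is invariant. -/
theorem PlaneAut.exists_deformation {K : Type*} [Field K] (φ : PlaneAut K) :
    ∃ U V : MvPolynomial (Fin 3) K, evalFirstZero K U = X 0 ∧ evalFirstZero K V = X 1 ∧
      ¬ (degreeOf 0 U = 0 ∧ degreeOf 0 V = 0) ∧
      aeval ![U, V] (φ.symm (X 0)) = rename Fin.succ (φ.symm (X 0)) := by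
  let θ : MvPolynomial (Fin 2) K →ₐ[K] MvPolynomial (Fin 3) K :=
    aeval ![rename Fin.succ (φ.symm (X 0)), rename Fin.succ (φ.symm (X 1)) + X 0]
  let δ := θ.comp (φ : MvPolynomial (Fin 2) K →ₐ[K] MvPolynomial (Fin 2) K)
  have hδ : δ = aeval ![δ (X 0), δ (X 1)] := by
    ext1 i
    fin_cases i <;> simp
  have hε : (evalFirstZero K).comp δ = AlgHom.id K _ := by
    have h1 : (evalFirstZero K).comp θ = (φ.symm : MvPolynomial (Fin 2) K →ₐ[K] _) := by
      ext1 i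
      fin_cases i
      · simp [θ, evalFirstZero_rename_succ]
      · simp only [θ, AlgHom.comp_apply, aeval_X, Fin.mk_one, Matrix.cons_val_one,
          Matrix.cons_val_zero, map_add, evalFirstZero_rename_succ]
        simp [evalFirstZero]
    rw [show (evalFirstZero K).comp δ = ((evalFirstZero K).comp θ).comp
      (φ : MvPolynomial (Fin 2) K →ₐ[K] MvPolynomial (Fin 2) K) from rfl, h1]
    ext1 i
    simp
  have hεi : ∀ p, evalFirstZero K (δ p) = p := fun p => congrArg (fun ψ => ψ p) hε
  refine ⟨δ (X 0), δ (X 1), hεi _, hεi _, ?_, ?_⟩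
  · rintro ⟨h0, h1⟩
    have hδ2 : δ = rename Fin.succ := by
      ext1 i
      fin_cases i
      · exact (rename_succ_evalFirstZero h0).symm.trans (by rw [hεi]; rfl)
      · exact (rename_succ_evalFirstZero h1).symm.trans (by rw [hεi]; rfl)
    have h2 : δ (φ.symm (X 1)) = rename Fin.succ (φ.symm (X 1)) + X 0 := by
      simp [δ, θ]
    rw [hδ2, left_eq_add] at h2
    exact X_ne_zero _ h2
  · rw [← hδ]
    simp [δ, θ]

theorem isHomogeneous_pair_of_weight {K : Type*} [Field K] {a b d : ℕ} (hd : 0 < d) {N : ℚ}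
    {r : MvPolynomial (Fin 2) K}
    (hr : IsWeightedHomogeneous ![((d * a : ℕ) : ℚ), ((d * b : ℕ) : ℚ)] r N) :
    ∀ e ∈ r.support, ∀ e' ∈ r.support, a * e 0 + b * e 1 = a * e' 0 + b * e' 1 := by
  intro e he e' he'
  have h1 := hr (mem_support_iff.mp he)
  have h2 := hr (mem_support_iff.mp he')
  rw [weight_fin_two] at h1 h2
  have h3 : d * (a * e 0 + b * e 1) = d * (a * e' 0 + b * e' 1) := by
    have : ((d * (a * e 0 + b * e 1) : ℕ) : ℚ) = (d * (a * e' 0 + b * e' 1) : ℕ) := by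
      push_cast at h1 h2 ⊢
      linarith
    exact_mod_cast this
  exact Nat.eq_of_mul_eq_mul_left hd h3

/-- The leading forms `f, g` of an automorphism satisfy `f ^ m = c g ^ n` with `m = 1` or `n = 1`,
provided `φ⁻¹ x` has weighted degree at least `2` for the weights `deg (φ x), deg (φ y)`. -/
theorem PlaneAut.leadingForm_relation {K : Type u} [Field K] (φ : PlaneAut K) {a b : ℕ}
    (ha : 0 < a) (hb : 0 < b) {f g : MvPolynomial (Fin 2) K}
    (hf : HasLeadingForm (fun _ => 1) a (φ (X 0)) f)
    (hg : HasLeadingForm (fun _ => 1) b (φ (X 1)) g)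
    (hf0 : f ≠ 0) (hg0 : g ≠ 0)
    (hdeg : ∃ e ∈ (φ.symm (X 0)).support, 1 < a * e 0 + b * e 1) :
    ∃ (m n : ℕ) (c : K), c ≠ 0 ∧ (m = 1 ∨ n = 1) ∧ a * m = b * n ∧ f ^ m = C c * g ^ n := by
  classical
  set R := φ.symm (X 0) with hR
  obtain ⟨m, hm, hmax⟩ := Finset.exists_max_image R.support (Finsupp.weight ![(a : ℚ), (b : ℚ)])
    (by obtain ⟨e, he, -⟩ := hdeg; exact ⟨e, he⟩)
  set N := Finsupp.weight ![(a : ℚ), (b : ℚ)] m with hN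
  set r : MvPolynomial (Fin 2) K := weightedHomogeneousComponent ![(a : ℚ), (b : ℚ)] N R with hr
  have hRr : HasLeadingForm ![(a : ℚ), (b : ℚ)] N R r := ⟨hmax, rfl⟩
  have hr0 : r ≠ 0 := by
    intro h
    have := congrArg (coeff m) h
    rw [hr, coeff_weightedHomogeneousComponent, if_pos rfl, coeff_zero] at this
    exact mem_support_iff.mp hm this
  have hN1 : 1 < N := by
    obtain ⟨e, he, h1⟩ := hdeg
    refine lt_of_lt_of_le ?_ (hmax e he)
    rw [weight_fin_two]
    have : (1 : ℚ) < ((a * e 0 + b * e 1 : ℕ) : ℚ) := by exact_mod_cast h1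
    push_cast at this
    linarith
  -- `X 0 = R(φ x, φ y)` has degree `1 < N`, so the leading part of `R` vanishes at `(f, g)`.
  have hrfg : aeval ![f, g] r = 0 := by
    have hfg : ∀ i, HasLeadingForm (fun _ => 1) (![(a : ℚ), (b : ℚ)] i) (![φ (X 0), φ (X 1)] i)
        (![f, g] i) := by
      intro i
      fin_cases i
      · exact hf
      · exact hg
    have h1 := HasLeadingForm.aeval hfg hRr
    have h2 : aeval ![φ (X 0), φ (X 1)] R = X 0 := by
      have hφR : φ R = X 0 := φ.apply_symm_apply _
      have := algHom_aeval_pair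
        (φ : MvPolynomial (Fin 2) K →ₐ[K] MvPolynomial (Fin 2) K) (X 0) (X 1) R
      rw [show ![X 0, X 1] = (X : Fin 2 → MvPolynomial (Fin 2) K) from ?_,
        aeval_X_left_apply] at this
      · exact this.symm.trans hφR
      · ext1 i
        fin_cases i <;> rfl
    rw [h2] at h1
    have h3 := (hasLeadingForm_X (K := K) (fun _ : Fin 2 => (1 : ℚ)) 0).of_lt hN1
    exact h1.2.symm.trans h3.2
  obtain ⟨d, a', b', hd, hab, rfl, rfl⟩ : ∃ d a' b', 0 < d ∧ Nat.Coprime a' b' ∧ a = d * a' ∧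
      b = d * b' := by
    obtain ⟨a', b', h1, h2, h3⟩ := Nat.exists_coprime a b
    exact ⟨_, a', b', Nat.gcd_pos_of_pos_left b ha, h1, by rw [mul_comm]; exact h2,
      by rw [mul_comm]; exact h3⟩
  have ha' := Nat.pos_of_mul_pos_left ha
  have hb' := Nat.pos_of_mul_pos_left hb
  have hom := isHomogeneous_pair_of_weight hd (weightedHomogeneousComponent_isWeightedHomogeneous
    (w := ![((d * a' : ℕ) : ℚ), ((d * b' : ℕ) : ℚ)]) (n := N) (φ := R))
  obtain ⟨c, hc, hfg, t, ht⟩ := exists_dvd_of_aeval_eq_zero hb' hab hr0 hom hf0 hg0 hrfg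
  refine ⟨b', a', c, hc, ?_, by ring, hfg⟩
  by_contra hne
  obtain ⟨U, V, hU, hV, hUV, hUVR⟩ := φ.exists_deformation
  rw [← hR] at hUVR
  obtain ⟨s, F, G, hF, hG, hFG⟩ := exists_weight_leadingForm ((d * a' : ℕ) : ℚ) ((d * b' : ℕ) : ℚ)
    hU hV hUV
  have hF0 : evalFirstZero K F = X 0 := by
    rw [← hF.2, evalFirstZero_weightedHomogeneousComponent, hU]
    exact (hasLeadingForm_X ![((d * a' : ℕ) : ℚ), ((d * b' : ℕ) : ℚ)] 0).2
  have hG0 : evalFirstZero K G = X 1 := by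
    rw [← hG.2, evalFirstZero_weightedHomogeneousComponent, hV]
    exact (hasLeadingForm_X ![((d * a' : ℕ) : ℚ), ((d * b' : ℕ) : ℚ)] 1).2
  -- The leading part of the identity `R(U, V) = R(u, v)`.
  have hlead : aeval ![F, G] r = rename Fin.succ r := by
    have h1 : HasLeadingForm ![s, ((d * a' : ℕ) : ℚ), ((d * b' : ℕ) : ℚ)] N (aeval ![U, V] R)
        (aeval ![F, G] r) := by
      refine HasLeadingForm.aeval (fun i => ?_) hRr
      fin_cases i
      · exact hF
      · exact hG
    have h2 : HasLeadingForm ![s, ((d * a' : ℕ) : ℚ), ((d * b' : ℕ) : ℚ)] N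
        (rename Fin.succ R) (rename Fin.succ r) := by
      let x : Fin 2 → MvPolynomial (Fin 3) K := fun i => X i.succ
      have hx : rename (R := K) (Fin.succ : Fin 2 → Fin 3) = aeval x := by
        ext1 i
        simp [x]
      rw [hx]
      refine HasLeadingForm.aeval (fun i => ?_) hRr
      exact hasLeadingForm_X ![s, ((d * a' : ℕ) : ℚ), ((d * b' : ℕ) : ℚ)] i.succ
    rw [hUVR] at h1
    rw [← h1.2]
    exact h2.2
  have hsucc0 : (rename (Fin.succ : Fin 2 → Fin 3) r) ≠ 0 :=
    (map_ne_zero_iff (rename (R := K) (Fin.succ : Fin 2 → Fin 3))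
      (rename_injective _ (Fin.succ_injective 2))).mpr hr0
  rw [ht, map_mul, ← ht] at hlead
  -- The binomial divides `r`, so its value at `(F, G)` divides `r(u, v)`, which is free of `s`.
  have hz := degreeOf_eq_zero_of_mul hlead hsucc0 (degreeOf_zero_rename_succ r)
  have hz2 := rename_succ_evalFirstZero hz
  simp only [map_sub, map_mul, map_pow, aeval_X, algHom_C, algebraMap_eq, hF0, hG0, rename_X,
    Matrix.cons_val_zero, Matrix.cons_val_one, Fin.succ_zero_eq_one, Fin.succ_one_eq_two] at hz2
  push Not at hne
  exact hFG (degreeOf_eq_zero_of_pow_sub_pow (by omega) (by omega) hab.symm hc hz2.symm)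

/-! ### The reduction step -/

section TotalDegree
variable {σ K : Type*} [Field K]

theorem weight_one_eq_degree (e : σ →₀ ℕ) :
    Finsupp.weight (fun _ => (1 : ℚ)) e = ((e.sum fun _ n => n : ℕ) : ℚ) := by
  rw [Finsupp.weight_apply, Finsupp.sum, Finsupp.sum]
  simp

theorem exists_hasLeadingForm_totalDegree {p : MvPolynomial σ K} (hp : p ≠ 0) :
    ∃ q, q ≠ 0 ∧ HasLeadingForm (fun _ => 1) p.totalDegree p q := by
  classical
  refine ⟨weightedHomogeneousComponent (fun _ => (1 : ℚ)) (p.totalDegree : ℚ) p, ?_,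
    fun e he => ?_, rfl⟩
  · obtain ⟨m, hm, hdeg⟩ := Finset.exists_mem_eq_sup p.support (support_nonempty.mpr hp)
      (fun s => s.sum fun _ e => e)
    intro h
    have h1 := congrArg (coeff m) h
    rw [coeff_weightedHomogeneousComponent, if_pos, coeff_zero] at h1
    · exact mem_support_iff.mp hm h1
    · rw [weight_one_eq_degree, ← hdeg]; rfl
  · rw [weight_one_eq_degree]
    exact_mod_cast le_totalDegree he

theorem totalDegree_lt_of_hasLeadingForm_zero {p : MvPolynomial σ K} {n : ℕ} (hn : 0 < n)
    (h : HasLeadingForm (fun _ => 1) (n : ℚ) p 0) : p.totalDegree < n := by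
  classical
  rw [totalDegree, Finset.sup_lt_iff (by simpa using hn)]
  intro e he
  have h1 := h.1 e he
  rw [weight_one_eq_degree] at h1
  have h2 : (e.sum fun _ n => n) ≤ n := by exact_mod_cast h1
  refine lt_of_le_of_ne h2 fun h3 => ?_
  have h4 := congrArg (coeff e) h.2
  rw [coeff_weightedHomogeneousComponent, if_pos (by rw [weight_one_eq_degree, h3]), coeff_zero]
    at h4
  exact mem_support_iff.mp he h4

end TotalDegree

namespace PlaneAut
variable {K : Type u} [Field K]

theorem totalDegree_pos (φ : PlaneAut K) (i : Fin 2) : 0 < (φ (X i)).totalDegree := by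
  rw [Nat.pos_iff_ne_zero]
  intro h
  rw [totalDegree_eq_zero_iff_eq_C] at h
  have h1 : φ (X i) = φ (C (coeff 0 (φ (X i)))) := by
    rw [← algebraMap_eq, AlgEquiv.commutes, algebraMap_eq]
    exact h
  have h2 := congrArg totalDegree (φ.injective h1)
  rw [totalDegree_X, totalDegree_C] at h2
  exact one_ne_zero h2

theorem ext_X {φ ψ : PlaneAut K} (h0 : φ (X 0) = ψ (X 0)) (h1 : φ (X 1) = ψ (X 1)) : φ = ψ := by
  have : (φ : MvPolynomial (Fin 2) K →ₐ[K] MvPolynomial (Fin 2) K) = ψ := by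
    ext1 i
    fin_cases i
    · exact h0
    · exact h1
  ext1 p
  exact congrArg (fun f => f p) this

/-- The automorphism exchanging `x` and `y`. -/
noncomputable def swap (K : Type u) [Field K] : PlaneAut K :=
  renameEquiv K (Equiv.swap 0 1)

theorem swap_X_zero : swap K (X 0) = X 1 := by simp [swap]

theorem swap_X_one : swap K (X 1) = X 0 := by simp [swap]

theorem swap_symm : (swap K).symm = swap K := by
  simp [swap]

theorem totalDegree_swap (p : MvPolynomial (Fin 2) K) :
    (swap K p).totalDegree = p.totalDegree :=
  totalDegree_renameEquiv _ p

theorem exists_totalDegree_sub_lt_of_symm (φ : PlaneAut K)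
    (hle : (φ (X 0)).totalDegree ≤ (φ (X 1)).totalDegree)
    (hdeg : ∃ e ∈ (φ.symm (X 0)).support,
      1 < (φ (X 0)).totalDegree * e 0 + (φ (X 1)).totalDegree * e 1) :
    ∃ (k : ℕ) (c : K), (φ (X 1)).totalDegree = (φ (X 0)).totalDegree * k ∧
      (φ (X 1) - C c * φ (X 0) ^ k).totalDegree < (φ (X 1)).totalDegree := by
  have ha := φ.totalDegree_pos 0
  have hb := φ.totalDegree_pos 1
  obtain ⟨f, hf0, hf⟩ := exists_hasLeadingForm_totalDegree
    ((map_ne_zero_iff φ φ.injective).mpr (X_ne_zero 0))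
  obtain ⟨g, hg0, hg⟩ := exists_hasLeadingForm_totalDegree
    ((map_ne_zero_iff φ φ.injective).mpr (X_ne_zero 1))
  obtain ⟨m, n, c, hc, hmn, hab, hfg⟩ := φ.leadingForm_relation ha hb hf hg hf0 hg0 hdeg
  obtain rfl : n = 1 := by
    rcases hmn with rfl | rfl
    · rcases Nat.lt_or_ge 1 n with h | h
      · nlinarith
      · rcases Nat.lt_or_ge 0 n with h' | h'
        · omega
        · have : n = 0 := by omega
          subst this
          omega
    · rfl
  rw [mul_one] at hab
  rw [pow_one] at hfg
  refine ⟨m, c⁻¹, hab.symm, ?_⟩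
  apply totalDegree_lt_of_hasLeadingForm_zero hb
  have h1 : HasLeadingForm (fun _ => 1) (((φ (X 1)).totalDegree : ℕ) : ℚ) (φ (X 0) ^ m)
      (f ^ m) := by
    rw [← hab]
    have := hf.pow m
    rwa [nsmul_eq_mul, mul_comm, ← Nat.cast_mul] at this
  have h2 := (HasLeadingForm.const (fun _ => 1) (-c⁻¹)).mul h1
  rw [zero_add] at h2
  have h3 := hg.add h2
  rw [hfg, ← mul_assoc, ← C_mul, neg_mul, inv_mul_cancel₀ hc, C_neg, C_neg, C_1, neg_one_mul,
    add_neg_cancel, neg_mul, ← sub_eq_add_neg] at h3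
  exact h3

/-- A polynomial not involving `y` is unchanged by `y ↦ 0`. -/
theorem eq_aeval_of_forall_support {p : MvPolynomial (Fin 2) K} (h : ∀ e ∈ p.support, e 1 = 0) :
    aeval ![X 0, (0 : MvPolynomial (Fin 2) K)] p = p := by
  have h1 : (1 : Fin 2) ∉ p.vars := by
    classical
    intro h1
    obtain ⟨d, hd, hd0⟩ := (mem_vars_iff_mem_support 1).mp h1
    exact (Finsupp.mem_support_iff.mp hd0) (h d hd)
  have := hom_congr_vars (R := K) (f₁ := ((aeval ![X 0, (0 : MvPolynomial (Fin 2) K)]) :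
      MvPolynomial (Fin 2) K →ₐ[K] MvPolynomial (Fin 2) K).toRingHom) (f₂ := RingHom.id _)
    (p₁ := p) (p₂ := p) ?_ ?_ rfl
  · exact this
  · ext r
    simp
  · intro i hi _
    fin_cases i
    · simp
    · exact absurd hi h1

/-- The reduction step of the Jung–van der Kulk theorem, over an arbitrary field: in an
automorphism `(f, g)` with `deg f ≤ deg g` and `deg g ≥ 2`, subtracting a scalar multiple of a
power of `f` lowers the degree of `g`, and `deg f ∣ deg g`. -/
theorem exists_totalDegree_sub_lt (φ : PlaneAut K)
    (hle : (φ (X 0)).totalDegree ≤ (φ (X 1)).totalDegree) (h2 : 2 ≤ (φ (X 1)).totalDegree) :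
    ∃ (k : ℕ) (c : K), (φ (X 1)).totalDegree = (φ (X 0)).totalDegree * k ∧
      (φ (X 1) - C c * φ (X 0) ^ k).totalDegree < (φ (X 1)).totalDegree := by
  by_cases h0 : ∃ e ∈ (φ.symm (X 0)).support,
      1 < (φ (X 0)).totalDegree * e 0 + (φ (X 1)).totalDegree * e 1
  · exact φ.exists_totalDegree_sub_lt_of_symm hle h0
  by_cases h1 : ∃ e ∈ (φ.symm (X 1)).support,
      1 < (φ (X 0)).totalDegree * e 0 + (φ (X 1)).totalDegree * e 1
  · have hsw : ∀ p, (φ.trans (swap K)) p = swap K (φ p) := fun _ => rfl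
    have hsym : (φ.trans (swap K)).symm (X 0) = φ.symm (X 1) := by
      show φ.symm ((swap K).symm (X 0)) = _
      rw [swap_symm, swap_X_zero]
    have key := exists_totalDegree_sub_lt_of_symm (φ.trans (swap K))
      (by rw [hsw, hsw, totalDegree_swap, totalDegree_swap]; exact hle)
      (by rw [hsw, hsw, totalDegree_swap, totalDegree_swap, hsym]; exact h1)
    obtain ⟨k, c, hk, hc⟩ := key
    rw [hsw, hsw, totalDegree_swap, totalDegree_swap] at hk
    refine ⟨k, c, hk, ?_⟩
    have hC : swap K (C c) = C c := (swap K).commutes c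
    rwa [hsw, hsw, totalDegree_swap, ← hC, ← map_pow, ← map_mul, ← map_sub, totalDegree_swap] at hc
  -- Otherwise `φ⁻¹ x` and `φ⁻¹ y` are both polynomials in `u` alone, and cannot generate `K[u, v]`.
  exfalso
  have hzero : ∀ i : Fin 2, aeval ![X 0, (0 : MvPolynomial (Fin 2) K)] (φ.symm (X i)) =
      φ.symm (X i) := by
    intro i
    apply eq_aeval_of_forall_support
    intro e he
    have hle1 : (φ (X 0)).totalDegree * e 0 + (φ (X 1)).totalDegree * e 1 ≤ 1 := by
      fin_cases i
      · exact not_lt.mp fun h => h0 ⟨e, he, h⟩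
      · exact not_lt.mp fun h => h1 ⟨e, he, h⟩
    by_contra hne
    have : 1 ≤ e 1 := Nat.one_le_iff_ne_zero.mpr hne
    nlinarith
  have hcomp : (aeval ![X 0, (0 : MvPolynomial (Fin 2) K)]).comp
      (φ.symm : MvPolynomial (Fin 2) K →ₐ[K] MvPolynomial (Fin 2) K) = φ.symm := by
    ext1 i
    exact hzero i
  have h3 := congrArg (fun ψ => ψ (φ (X 1))) hcomp
  simp at h3
  exact X_ne_zero _ h3.symm

end PlaneAut

/-! ### Counting by bidegree -/

namespace PlaneAut
variable {K : Type u} [Field K]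

/-- The elementary automorphism `x ↦ x`, `y ↦ y + c x ^ k`. Precomposing `(f, g)` with it gives
`(f, g + c f ^ k)`. -/
noncomputable def shear (c : K) (k : ℕ) : PlaneAut K :=
  AlgEquiv.ofAlgHom (aeval ![X 0, X 1 + C c * X 0 ^ k]) (aeval ![X 0, X 1 - C c * X 0 ^ k])
    (by ext1 i; fin_cases i <;> simp [algHom_C, algebraMap_eq])
    (by ext1 i; fin_cases i <;> simp [algHom_C, algebraMap_eq])

theorem shear_trans_X_zero (c : K) (k : ℕ) (φ : PlaneAut K) :
    ((shear c k).trans φ) (X 0) = φ (X 0) := by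
  simp [shear]

theorem shear_trans_X_one (c : K) (k : ℕ) (φ : PlaneAut K) :
    ((shear c k).trans φ) (X 1) = φ (X 1) + C c * φ (X 0) ^ k := by
  have hC : φ (C c) = C c := φ.commutes c
  simp [shear, hC]

theorem swap_trans_X_zero (φ : PlaneAut K) : ((swap K).trans φ) (X 0) = φ (X 1) := by
  simp [swap_X_zero]

theorem swap_trans_X_one (φ : PlaneAut K) : ((swap K).trans φ) (X 1) = φ (X 0) := by
  simp [swap_X_one]

theorem totalDegree_C_mul_pow {p : MvPolynomial (Fin 2) K} (hp : p ≠ 0) {c : K} (hc : c ≠ 0)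
    (k : ℕ) : (C c * p ^ k).totalDegree = p.totalDegree * k := by
  have hpow : ∀ k : ℕ, (p ^ k).totalDegree = p.totalDegree * k := by
    intro k
    induction k with
    | zero => simp
    | succ k ih => rw [pow_succ, totalDegree_mul_of_isDomain (pow_ne_zero _ hp) hp, ih, mul_add_one]
  rw [totalDegree_mul_of_isDomain (C_ne_zero.mpr hc) (pow_ne_zero _ hp), totalDegree_C, zero_add,
    hpow]

theorem X_ne (φ : PlaneAut K) (i : Fin 2) : φ (X i) ≠ 0 :=
  (map_ne_zero_iff φ φ.injective).mpr (X_ne_zero i)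

/-- The automorphisms `(f, g)` with `deg f = a` and `deg g < n`. -/
abbrev Bounded (K : Type u) [Field K] (a n : ℕ) : Type u :=
  {φ : PlaneAut K // (φ (X 0)).totalDegree = a ∧ (φ (X 1)).totalDegree < n}

/-- The automorphisms `(f, g)` with `deg f = a` and `deg g = b`. -/
abbrev Bidegree (K : Type u) [Field K] (a b : ℕ) : Type u :=
  {φ : PlaneAut K // (φ (X 0)).totalDegree = a ∧ (φ (X 1)).totalDegree = b}

theorem card_bounded_succ_of_not_dvd {a n : ℕ} (han : a ≤ n) (hn : 2 ≤ n) (h : ¬ a ∣ n) :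
    Nat.card (Bounded K a (n + 1)) = Nat.card (Bounded K a n) := by
  refine Nat.card_congr (Equiv.subtypeEquivRight fun φ => ?_)
  refine and_congr_right fun ha => ?_
  rw [Nat.lt_succ_iff_lt_or_eq, or_iff_left]
  intro hb
  obtain ⟨k, -, hk, -⟩ := φ.exists_totalDegree_sub_lt (by omega) (by omega)
  exact h ⟨k, by rw [← hb, hk, ha]⟩

/-- Each `(f, g)` with `deg f = a` and `deg g ≤ a k` is `(f, g' + c f ^ k)` for a unique scalar `c`
and a unique `(f, g')` with `deg g' < a k`. -/
theorem card_bounded_succ_of_dvd {a k : ℕ} (han : a ≤ a * k) (hn : 2 ≤ a * k) :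
    Nat.card (Bounded K a (a * k + 1)) = Nat.card K * Nat.card (Bounded K a (a * k)) := by
  rw [← Nat.card_prod]
  symm
  have hle : ∀ (c : K) (φ : Bounded K a (a * k)),
      (C c * φ.1 (X 0) ^ k).totalDegree ≤ a * k := by
    intro c φ
    rcases eq_or_ne c 0 with rfl | hc
    · simp
    · rw [totalDegree_C_mul_pow (X_ne _ _) hc, φ.2.1]
  refine Nat.card_congr (Equiv.ofBijective
    (fun p => ⟨(shear p.1 k).trans p.2.1, ?_, ?_⟩) ⟨?_, ?_⟩)
  · rw [shear_trans_X_zero]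
    exact p.2.2.1
  · rw [shear_trans_X_one]
    have h1 := totalDegree_add (p.2.1 (X 1)) (C p.1 * p.2.1 (X 0) ^ k)
    have h2 := p.2.2.2
    have h3 := hle p.1 p.2
    omega
  · rintro ⟨c, φ⟩ ⟨d, ψ⟩ h
    have h0 := congrArg Subtype.val h
    have h1 := congrArg (fun χ : PlaneAut K => χ (X 0)) h0
    have h2 := congrArg (fun χ : PlaneAut K => χ (X 1)) h0
    simp only [shear_trans_X_zero, shear_trans_X_one] at h1 h2
    have hcd : c = d := by
      by_contra hne
      have h3 : C (c - d) * φ.1 (X 0) ^ k = ψ.1 (X 1) - φ.1 (X 1) := by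
        rw [C_sub]
        rw [← h1] at h2
        linear_combination h2
      have h4 := congrArg totalDegree h3
      rw [totalDegree_C_mul_pow (X_ne _ _) (sub_ne_zero.mpr hne), φ.2.1] at h4
      have h5 := totalDegree_sub (ψ.1 (X 1)) (φ.1 (X 1))
      have h6 := φ.2.2
      have h7 := ψ.2.2
      omega
    subst hcd
    rw [h1, add_left_inj] at h2
    rw [Prod.mk.injEq]
    exact ⟨rfl, Subtype.ext (ext_X h1 h2)⟩
  · rintro ⟨ψ, hψ0, hψ1⟩
    obtain ⟨c, hc⟩ : ∃ c, (ψ (X 1) - C c * ψ (X 0) ^ k).totalDegree < a * k := by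
      rcases Nat.lt_succ_iff_lt_or_eq.mp hψ1 with h | h
      · exact ⟨0, by simpa using h⟩
      · obtain ⟨l, c, hl, hc⟩ := ψ.exists_totalDegree_sub_lt (by omega) (by omega)
        have : l = k := by
          rw [hψ0, h] at hl
          exact (Nat.eq_of_mul_eq_mul_left (by nlinarith [ψ.totalDegree_pos 0]) hl).symm
        subst this
        exact ⟨c, by rwa [h] at hc⟩
    refine ⟨⟨c, ⟨(shear (-c) k).trans ψ, ?_, ?_⟩⟩, ?_⟩
    · rw [shear_trans_X_zero, hψ0]
    · rw [shear_trans_X_one, C_neg, neg_mul, ← sub_eq_add_neg]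
      exact hc
    · apply Subtype.ext
      apply ext_X
      · rw [shear_trans_X_zero, shear_trans_X_zero]
      · rw [shear_trans_X_one]
        have : ((shear (-c) k).trans ψ) (X 1) + C c * ((shear (-c) k).trans ψ) (X 0) ^ k =
            ψ (X 1) := by
          rw [shear_trans_X_one, shear_trans_X_zero, C_neg]
          ring
        exact this

/-- The exponent counts the multiples of `a` in `[t, n)`. -/
theorem card_bounded {a : ℕ} {t : ℕ} (hat : a ≤ t) (h2 : 2 ≤ t) (n : ℕ) (htn : t ≤ n)
    (ha : 0 < a) :
    Nat.card (Bounded K a n) =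
      Nat.card K ^ ((n - 1) / a - (t - 1) / a) * Nat.card (Bounded K a t) := by
  induction n, htn using Nat.le_induction with
  | base => simp
  | succ n hn ih =>
    obtain ⟨m, rfl⟩ : ∃ m, n = m + 1 := ⟨n - 1, by omega⟩
    rw [Nat.add_sub_cancel] at ih ⊢
    by_cases h : a ∣ m + 1
    · obtain ⟨k, hk⟩ := h
      have hdiv : (m + 1) / a = m / a + 1 := by
        rw [Nat.succ_div, if_pos ⟨k, hk⟩]
      have hle : (t - 1) / a ≤ m / a := Nat.div_le_div_right (by omega)
      have := card_bounded_succ_of_dvd (K := K) (a := a) (k := k) (by omega) (by omega)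
      rw [← hk] at this
      rw [this, ih, hdiv, Nat.sub_add_comm hle, pow_succ]
      ring
    · rw [card_bounded_succ_of_not_dvd (by omega) (by omega) h, ih, Nat.succ_div, if_neg h,
        add_zero]

theorem card_swap (P : ℕ → ℕ → Prop) :
    Nat.card {φ : PlaneAut K // P (φ (X 0)).totalDegree (φ (X 1)).totalDegree} =
      Nat.card {φ : PlaneAut K // P (φ (X 1)).totalDegree (φ (X 0)).totalDegree} := by
  refine Nat.card_congr ⟨fun φ => ⟨(swap K).trans φ.1, ?_⟩, fun φ => ⟨(swap K).trans φ.1, ?_⟩,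
    fun φ => ?_, fun φ => ?_⟩
  · rw [swap_trans_X_zero, swap_trans_X_one]; exact φ.2
  · rw [swap_trans_X_zero, swap_trans_X_one]; exact φ.2
  · exact Subtype.ext (ext_X (by rw [swap_trans_X_zero, swap_trans_X_one])
      (by rw [swap_trans_X_one, swap_trans_X_zero]))
  · exact Subtype.ext (ext_X (by rw [swap_trans_X_zero, swap_trans_X_one])
      (by rw [swap_trans_X_one, swap_trans_X_zero]))

section Finite
variable [Finite K]

theorem finite_totalDegree_le (n : ℕ) :
    Finite {φ : PlaneAut K // (φ (X 0)).totalDegree ≤ n ∧ (φ (X 1)).totalDegree ≤ n} := by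
  have : Finite (restrictTotalDegree (Fin 2) K n) := Module.finite_of_finite K
  refine Finite.of_injective
    (β := restrictTotalDegree (Fin 2) K n × restrictTotalDegree (Fin 2) K n)
    (fun φ => (⟨φ.1 (X 0), (mem_restrictTotalDegree _ _ _).mpr φ.2.1⟩,
      ⟨φ.1 (X 1), (mem_restrictTotalDegree _ _ _).mpr φ.2.2⟩)) ?_
  rintro φ ψ h
  simp only [Prod.mk.injEq, Subtype.mk.injEq] at h
  exact Subtype.ext (ext_X h.1 h.2)

theorem finite_of_imp {P : PlaneAut K → Prop} (n : ℕ)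
    (h : ∀ φ, P φ → (φ (X 0)).totalDegree ≤ n ∧ (φ (X 1)).totalDegree ≤ n) :
    Finite {φ // P φ} :=
  have := finite_totalDegree_le (K := K) n
  Finite.of_injective (fun φ : {φ // P φ} => (⟨φ.1, h φ.1 φ.2⟩ :
    {φ : PlaneAut K // (φ (X 0)).totalDegree ≤ n ∧ (φ (X 1)).totalDegree ≤ n}))
    fun _ _ h => Subtype.ext (congrArg (fun χ => χ.1) h)

instance (a n : ℕ) : Finite (Bounded K a n) :=
  finite_of_imp (max a n) fun φ h => by omega

instance (a n : ℕ) : Finite (Bidegree K a n) :=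
  finite_of_imp (max a n) fun φ h => by omega

theorem _root_.Nat.card_subtype_eq_add {α : Type*} (P Q : α → Prop) [Finite {x // P x}] :
    Nat.card {x // P x} = Nat.card {x // P x ∧ Q x} + Nat.card {x // P x ∧ ¬ Q x} := by
  have hfin : Finite ({x | P x} : Set α) := ‹Finite {x // P x}›
  have := Set.ncard_inter_add_ncard_sdiff_eq_ncard {x | P x} {x | Q x}
    (Set.toFinite {x | P x})
  exact this.symm

theorem card_bidegree_add (a n : ℕ) :
    Nat.card (Bidegree K a n) + Nat.card (Bounded K a n) = Nat.card (Bounded K a (n + 1)) := by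
  rw [Nat.card_subtype_eq_add (fun φ : PlaneAut K => (φ (X 0)).totalDegree = a ∧
    (φ (X 1)).totalDegree < n + 1) (fun φ => (φ (X 1)).totalDegree = n)]
  congr 1
  · exact Nat.card_congr (Equiv.subtypeEquivRight fun φ => by omega)
  · exact Nat.card_congr (Equiv.subtypeEquivRight fun φ => by omega)

/-- Automorphisms of degree `n` have `deg f = n ≥ deg g` or `deg f < deg g = n`; by the reduction
step the first kind is `#K` times as frequent as the second. -/
theorem numPlaneAut_eq {n : ℕ} (hn : 2 ≤ n) :
    numPlaneAut K n = (Nat.card K + 1) * Nat.card (Bounded K n n) := by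
  have hfin : Finite {φ : PlaneAut K // φ.degree = n} :=
    finite_of_imp n fun φ h => by rw [PlaneAut.degree] at h; omega
  rw [numPlaneAut, Nat.card_subtype_eq_add (fun φ : PlaneAut K => φ.degree = n)
    (fun φ => (φ (X 0)).totalDegree = n), add_mul, one_mul]
  congr 1
  · have := card_bounded_succ_of_dvd (K := K) (a := n) (k := 1) (by omega) (by omega)
    rw [mul_one] at this
    rw [← this]
    exact Nat.card_congr (Equiv.subtypeEquivRight fun φ => by rw [PlaneAut.degree]; omega)
  · rw [card_swap (fun a b => a = n ∧ b < n)]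
    exact Nat.card_congr (Equiv.subtypeEquivRight fun φ => by rw [PlaneAut.degree]; omega)

theorem card_bounded_self (n : ℕ) :
    Nat.card (Bounded K n n) = ∑ a ∈ Finset.range n, Nat.card (Bidegree K a n) := by
  rw [card_swap (fun a b => a = n ∧ b < n), Finset.sum_range, ← Nat.card_sigma]
  exact Nat.card_congr
    { toFun := fun φ => ⟨⟨_, φ.2.2⟩, ⟨φ.1, rfl, φ.2.1⟩⟩
      invFun := fun φ => ⟨φ.2.1, φ.2.2.2, by rw [φ.2.2.1]; exact φ.1.2⟩
      left_inv := fun φ => rfl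
      right_inv := by
        rintro ⟨⟨a, ha⟩, ⟨φ, h0, h1⟩⟩
        have h2 : (φ (X 0)).totalDegree = a := h0
        subst h2
        rfl }

end Finite

end PlaneAut

/-! ### Affine automorphisms -/

namespace PlaneAut
variable {K : Type u} [Field K]

/-- The substitution `x_i ↦ ∑ j, M i j * x_j + t i`. -/
noncomputable def affineHom (M : Matrix (Fin 2) (Fin 2) K) (t : Fin 2 → K) :
    MvPolynomial (Fin 2) K →ₐ[K] MvPolynomial (Fin 2) K :=
  aeval fun i => ∑ j, C (M i j) * X j + C (t i)

theorem affineHom_comp (M N : Matrix (Fin 2) (Fin 2) K) (s t : Fin 2 → K) :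
    (affineHom M t).comp (affineHom N s) = affineHom (N * M) (N.mulVec t + s) := by
  ext1 i
  simp only [affineHom, AlgHom.comp_apply, aeval_X, map_add, map_mul, algHom_C,
    algebraMap_eq, Fin.sum_univ_two, Matrix.mul_apply, Matrix.mulVec, dotProduct, Pi.add_apply]
  ring

theorem affineHom_one_zero : affineHom (1 : Matrix (Fin 2) (Fin 2) K) 0 = AlgHom.id K _ := by
  ext1 i
  fin_cases i <;> simp [affineHom]

/-- The affine automorphism `x_i ↦ ∑ j, M i j * x_j + t i`, for an invertible matrix `M`. -/
noncomputable def affineAut (M : GL (Fin 2) K) (t : Fin 2 → K) : PlaneAut K :=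
  AlgEquiv.ofAlgHom (affineHom M.1 t) (affineHom (M⁻¹).1 (-((M⁻¹).1.mulVec t)))
    (by rw [affineHom_comp, add_neg_cancel, ← Units.val_mul, inv_mul_cancel, Units.val_one,
      affineHom_one_zero])
    (by rw [affineHom_comp, Matrix.mulVec_neg, Matrix.mulVec_mulVec, ← Units.val_mul,
      mul_inv_cancel, Units.val_one, Matrix.one_mulVec, neg_add_cancel, affineHom_one_zero])

theorem affineAut_X (M : GL (Fin 2) K) (t : Fin 2 → K) (i : Fin 2) :
    affineAut M t (X i) = ∑ j, C (M.1 i j) * X j + C (t i) := by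
  simp [affineAut, affineHom]

theorem eval_affineAut_X (M : GL (Fin 2) K) (t v : Fin 2 → K) (i : Fin 2) :
    eval v (affineAut M t (X i)) = M.1.mulVec v i + t i := by
  rw [affineAut_X]
  simp [Matrix.mulVec, dotProduct]

theorem totalDegree_affineAut_X (M : GL (Fin 2) K) (t : Fin 2 → K) (i : Fin 2) :
    (affineAut M t (X i)).totalDegree = 1 := by
  refine le_antisymm ?_ (totalDegree_pos _ _)
  rw [affineAut_X]
  refine (totalDegree_add _ _).trans (max_le ?_ (by simp))
  refine totalDegree_finsetSum_le fun j _ => (totalDegree_mul _ _).trans ?_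
  simp

theorem eq_sum_of_totalDegree_le_one {p : MvPolynomial (Fin 2) K} (hp : p.totalDegree ≤ 1) :
    p = ∑ j, C (coeff (Finsupp.single j 1) p) * X j + C (coeff 0 p) := by
  classical
  ext m
  simp only [Fin.sum_univ_two, coeff_add, coeff_C_mul, coeff_X, coeff_C]
  have hne : (Finsupp.single 0 1 : Fin 2 →₀ ℕ) ≠ Finsupp.single 1 1 := by
    intro h
    simpa using DFunLike.congr_fun h 0
  have hz : ∀ i : Fin 2, (Finsupp.single i 1 : Fin 2 →₀ ℕ) ≠ 0 := by simp
  by_cases h0 : 0 = m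
  · subst h0
    simp [hz]
  by_cases h1 : Finsupp.single 0 1 = m
  · subst h1
    simp [hne.symm, h0]
  by_cases h2 : Finsupp.single 1 1 = m
  · subst h2
    simp [hne, h0]
  rw [if_neg h0, if_neg h1, if_neg h2, mul_zero, mul_zero, add_zero, add_zero]
  by_contra hm
  have h3 := (le_totalDegree (mem_support_iff.mpr hm)).trans hp
  rw [Finsupp.sum_fintype _ _ (by simp), Fin.sum_univ_two] at h3
  have key : (m 0 = 0 ∧ m 1 = 0) ∨ (m 0 = 1 ∧ m 1 = 0) ∨ (m 0 = 0 ∧ m 1 = 1) := by omega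
  rcases key with ⟨e0, e1⟩ | ⟨e0, e1⟩ | ⟨e0, e1⟩
  · exact h0 (by ext i; fin_cases i <;> simp [e0, e1])
  · exact h1 (by ext i; fin_cases i <;> simp [e0, e1])
  · exact h2 (by ext i; fin_cases i <;> simp [e0, e1])

/-- The matrix of an automorphism of degree `1` is invertible: a linear relation between its rows
would make a nonzero linear form constant. -/
theorem exists_eq_affineAut (φ : PlaneAut K) (h : ∀ i, (φ (X i)).totalDegree ≤ 1) :
    ∃ M t, affineAut M t = φ := by
  let M : Matrix (Fin 2) (Fin 2) K := fun i j => coeff (Finsupp.single j 1) (φ (X i))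
  let t : Fin 2 → K := fun i => coeff 0 (φ (X i))
  have hφ : ∀ i, φ (X i) = ∑ j, C (M i j) * X j + C (t i) := fun i =>
    eq_sum_of_totalDegree_le_one (h i)
  have hM : IsUnit M.det := by
    rw [isUnit_iff_ne_zero]
    intro hdet
    obtain ⟨v, hv, hvM⟩ := Matrix.exists_vecMul_eq_zero_iff.mpr hdet
    have hC : ∀ c : K, φ (C c) = C c := φ.commutes
    have h1 : ∀ j, v 0 * M 0 j + v 1 * M 1 j = 0 := by
      intro j
      have := congrFun hvM j
      simpa [Matrix.vecMul, dotProduct] using this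
    have h2 : φ (C (v 0) * X 0 + C (v 1) * X 1) = φ (C (v 0 * t 0 + v 1 * t 1)) := by
      have e0 := congrArg (C : K → MvPolynomial (Fin 2) K) (h1 0)
      have e1 := congrArg (C : K → MvPolynomial (Fin 2) K) (h1 1)
      simp only [C_add, C_mul, C_0] at e0 e1
      simp only [map_add, map_mul, hC, hφ, Fin.sum_univ_two]
      linear_combination X 0 * e0 + X 1 * e1
    have h3 := φ.injective h2
    have h4 : ∀ x : Fin 2 → K, v 0 * x 0 + v 1 * x 1 = v 0 * t 0 + v 1 * t 1 := by
      intro x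
      simpa using congrArg (eval x) h3
    have z := h4 0
    have a0 := h4 ![1, 0]
    have a1 := h4 ![0, 1]
    simp only [Pi.zero_apply, mul_zero, add_zero, zero_add, mul_one, Matrix.cons_val_zero,
      Matrix.cons_val_one] at z a0 a1
    apply hv
    ext i
    fin_cases i
    · exact a0.trans z.symm
    · exact a1.trans z.symm
  refine ⟨Matrix.GeneralLinearGroup.mk'' M hM, t, ext_X ?_ ?_⟩
  · rw [affineAut_X, hφ]; rfl
  · rw [affineAut_X, hφ]; rfl

theorem affineAut_injective :
    Function.Injective fun p : GL (Fin 2) K × (Fin 2 → K) => affineAut p.1 p.2 := by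
  rintro ⟨M, s⟩ ⟨N, t⟩ h
  have h1 : ∀ v i, M.1.mulVec v i + s i = N.1.mulVec v i + t i := by
    intro v i
    rw [← eval_affineAut_X, ← eval_affineAut_X]
    exact congrArg (fun φ : PlaneAut K => eval v (φ (X i))) h
  have hst : s = t := by
    ext i
    simpa using h1 0 i
  subst hst
  have hMN : M = N := by
    apply Units.ext
    ext i j
    have := h1 (Pi.single j 1) i
    simpa using this
  rw [hMN]

theorem card_bounded_one_two [Finite K] :
    Nat.card (Bounded K 1 2) =
      (Nat.card K ^ 2 - 1) * (Nat.card K ^ 2 - Nat.card K) * Nat.card K ^ 2 := by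
  have := Fintype.ofFinite K
  have hGL : Nat.card (GL (Fin 2) K) = (Nat.card K ^ 2 - 1) * (Nat.card K ^ 2 - Nat.card K) := by
    rw [Matrix.card_GL_field, Fin.prod_univ_two, Nat.card_eq_fintype_card]
    simp
  rw [← hGL, show Nat.card K ^ 2 = Nat.card (Fin 2 → K) by simp, ← Nat.card_prod]
  symm
  refine Nat.card_congr (Equiv.ofBijective
    (fun p => ⟨affineAut p.1 p.2, totalDegree_affineAut_X _ _ _,
      by rw [totalDegree_affineAut_X]; exact one_lt_two⟩) ⟨?_, ?_⟩)
  · intro p p' h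
    exact affineAut_injective (congrArg Subtype.val h)
  · rintro ⟨φ, h0, h1⟩
    obtain ⟨M, t, rfl⟩ := φ.exists_eq_affineAut (fun i => by
      fin_cases i
      exacts [h0.le, Nat.lt_succ_iff.mp h1])
    exact ⟨(M, t), rfl⟩

end PlaneAut

/-! ### Ordered factorizations -/

/-- The divisors `a` of `n` with `1 < a < n`. -/
def nontrivialDivisors (n : ℕ) : Finset ℕ :=
  (Finset.range n).filter fun a => 2 ≤ a ∧ a ∣ n

theorem mem_nontrivialDivisors {a n : ℕ} : a ∈ nontrivialDivisors n ↔ a < n ∧ 2 ≤ a ∧ a ∣ n := by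
  simp [nontrivialDivisors]

/-- The number of ordered factorizations of `n` into factors `≥ 2`, by recursion on the product `a`
of all factors but one; the summand `1` stands for the factorization with the single factor `n`. It
is meant for `n ≥ 2`; the values at `0` and `1` are both `1`. -/
def numOrderedFactorizations (n : ℕ) : ℕ :=
  1 + ∑ a ∈ (nontrivialDivisors n).attach, numOrderedFactorizations a.1
termination_by n
decreasing_by exact (mem_nontrivialDivisors.mp a.2).1

theorem numOrderedFactorizations_eq (n : ℕ) : numOrderedFactorizations n =
    1 + ∑ a ∈ nontrivialDivisors n, numOrderedFactorizations a := by
  rw [numOrderedFactorizations, Finset.sum_attach (nontrivialDivisors n) numOrderedFactorizations]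

theorem nontrivialDivisors_div_mem {a n : ℕ} (h : a ∈ nontrivialDivisors n) :
    n / a ∈ nontrivialDivisors n ∧ a * (n / a) = n := by
  rw [mem_nontrivialDivisors] at h ⊢
  obtain ⟨h1, h2, k, rfl⟩ := h
  rw [Nat.mul_div_cancel_left _ (by omega)]
  refine ⟨⟨?_, ?_, Dvd.intro_left _ rfl⟩, rfl⟩
  · nlinarith [Nat.pos_of_ne_zero (show k ≠ 0 by rintro rfl; omega)]
  · by_contra h
    have : k = 0 ∨ k = 1 := by omega
    rcases this with rfl | rfl <;> omega

theorem sum_Ico_inv_sq_le (n : ℕ) (hn : 2 ≤ n) :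
    ∑ d ∈ Finset.Ico 2 n, ((d : ℝ) ^ 2)⁻¹ ≤ 1 - ((n : ℝ) - 1)⁻¹ := by
  induction n, hn using Nat.le_induction with
  | base => norm_num
  | succ n hn ih =>
    rw [Finset.sum_Ico_succ_top hn]
    have h2 : (2 : ℝ) ≤ n := by exact_mod_cast hn
    have h3 : ((n : ℝ) ^ 2)⁻¹ ≤ ((n : ℝ) - 1)⁻¹ - (n : ℝ)⁻¹ := by
      rw [inv_sub_inv (by linarith) (by linarith), inv_eq_one_div]
      apply div_le_div₀ <;> nlinarith
    push_cast
    rw [add_sub_cancel_right]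
    linarith

/-- Writing `a = n / d`, the sum is at most `n ^ 2 * ∑ d ∈ [2, n), 1 / d ^ 2`. -/
theorem sum_sq_nontrivialDivisors_le (n : ℕ) (hn : 2 ≤ n) :
    ∑ a ∈ nontrivialDivisors n, (a : ℝ) ^ 2 ≤ (n : ℝ) ^ 2 - 1 := by
  have h1 : ∑ a ∈ nontrivialDivisors n, (a : ℝ) ^ 2 =
      ∑ d ∈ nontrivialDivisors n, (n : ℝ) ^ 2 * ((d : ℝ) ^ 2)⁻¹ := by
    refine Finset.sum_bij' (fun a _ => n / a) (fun a _ => n / a)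
      (fun a ha => (nontrivialDivisors_div_mem ha).1)
      (fun a ha => (nontrivialDivisors_div_mem ha).1)
      (fun a ha => ?_) (fun a ha => ?_) (fun a ha => ?_)
    · exact Nat.div_div_self (mem_nontrivialDivisors.mp ha).2.2 (by omega)
    · exact Nat.div_div_self (mem_nontrivialDivisors.mp ha).2.2 (by omega)
    · obtain ⟨h1, h2⟩ := nontrivialDivisors_div_mem ha
      have h3 := (mem_nontrivialDivisors.mp h1).2.1
      have h4 : (n : ℝ) = a * (n / a : ℕ) := by rw [← Nat.cast_mul, h2]
      have h5 : ((n / a : ℕ) : ℝ) ≠ 0 := by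
        rw [Nat.cast_ne_zero]; omega
      rw [h4]
      field_simp
  have hsub : nontrivialDivisors n ⊆ Finset.Ico 2 n := by
    intro a ha
    rw [mem_nontrivialDivisors] at ha
    rw [Finset.mem_Ico]
    omega
  have h2 : (2 : ℝ) ≤ n := by exact_mod_cast hn
  rw [h1, ← Finset.mul_sum]
  have h3 := (Finset.sum_le_sum_of_subset_of_nonneg hsub (f := fun d : ℕ => ((d : ℝ) ^ 2)⁻¹)
    (fun _ _ _ => by positivity)).trans (sum_Ico_inv_sq_le n hn)
  have h4 : 1 ≤ (n : ℝ) ^ 2 * ((n : ℝ) - 1)⁻¹ := by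
    rw [← div_eq_mul_inv, one_le_div (by linarith)]
    nlinarith
  nlinarith [mul_le_mul_of_nonneg_left h3 (sq_nonneg (n : ℝ))]

theorem numOrderedFactorizations_le_sq (n : ℕ) (hn : 2 ≤ n) :
    (numOrderedFactorizations n : ℝ) ≤ (n : ℝ) ^ 2 := by
  induction n using Nat.strong_induction_on with
  | _ n ih =>
    rw [numOrderedFactorizations_eq]
    push_cast
    have h1 : ∑ a ∈ nontrivialDivisors n, (numOrderedFactorizations a : ℝ) ≤
        ∑ a ∈ nontrivialDivisors n, (a : ℝ) ^ 2 := by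
      refine Finset.sum_le_sum fun a ha => ?_
      rw [mem_nontrivialDivisors] at ha
      exact ih a ha.1 ha.2.1
    have h2 := sum_sq_nontrivialDivisors_le n hn
    linarith

theorem numOrderedFactorizations_le_three {n : ℕ} (hn : n < 8) (h2 : 2 ≤ n) :
    numOrderedFactorizations n ≤ 3 := by
  have h : ∀ m, nontrivialDivisors m = ∅ → numOrderedFactorizations m = 1 := by
    intro m hm
    rw [numOrderedFactorizations_eq, hm]; rfl
  have e2 := h 2 (by decide)
  have e3 := h 3 (by decide)
  interval_cases n
  · omega
  · omega
  · rw [numOrderedFactorizations_eq, show nontrivialDivisors 4 = {2} by decide]; simp [e2]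
  · rw [h 5 (by decide)]; omega
  · rw [numOrderedFactorizations_eq, show nontrivialDivisors 6 = {2, 3} by decide]; simp [e2, e3]
  · rw [h 7 (by decide)]; omega

/-- For `n ≥ 16` the number of ordered factorizations is at most `n ^ 2 = 4 ^ log₂ n ≤ (log₂ n) ^
log₂ n`; below `16` the inequality is checked on the ranges `[2, 4)`, `[4, 8)` and `[8, 16)`. -/
theorem sum_numOrderedFactorizations_le (n : ℕ) (hn : 2 ≤ n) :
    ((∑ a ∈ nontrivialDivisors n, numOrderedFactorizations a : ℕ) : ℝ) ≤
      (Real.logb 2 n) ^ (Real.logb 2 n) := by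
  have hpos : (0 : ℝ) < n := by positivity
  have hlog : ∀ k : ℕ, 2 ^ k ≤ n → (k : ℝ) ≤ Real.logb 2 n := by
    intro k hk
    rw [Real.le_logb_iff_rpow_le (by norm_num) hpos, Real.rpow_natCast]
    exact_mod_cast hk
  have hpow : ∀ k : ℕ, 1 ≤ k → 2 ^ k ≤ n →
      ((k ^ k : ℕ) : ℝ) ≤ (Real.logb 2 n) ^ (Real.logb 2 n) := by
    intro k hk hkn
    have h1 := hlog k hkn
    have hk' : (1 : ℝ) ≤ k := by exact_mod_cast hk
    calc ((k ^ k : ℕ) : ℝ) = (k : ℝ) ^ (k : ℝ) := by rw [Real.rpow_natCast]; push_cast; rfl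
      _ ≤ (k : ℝ) ^ (Real.logb 2 n) := Real.rpow_le_rpow_of_exponent_le hk' h1
      _ ≤ _ := Real.rpow_le_rpow (by linarith) h1 (by linarith)
  rcases Nat.lt_or_ge n 16 with h16 | h16
  · rcases Nat.lt_or_ge n 4 with h4 | h4
    · have h0 : nontrivialDivisors n = ∅ := by interval_cases n <;> decide
      rw [h0]
      simpa using (Nat.cast_nonneg _).trans (hpow 1 le_rfl hn)
    rcases Nat.lt_or_ge n 8 with h8 | h8
    · refine le_trans ?_ (hpow 2 (by norm_num) (by omega))
      have h := numOrderedFactorizations_le_three h8 hn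
      rw [numOrderedFactorizations_eq] at h
      exact_mod_cast (by omega : _ ≤ 2 ^ 2)
    · refine le_trans ?_ (hpow 3 (by norm_num) (by omega))
      have hcard : (nontrivialDivisors n).card ≤ 4 := by interval_cases n <;> decide
      have h : ∑ a ∈ nontrivialDivisors n, numOrderedFactorizations a ≤
          (nontrivialDivisors n).card • 3 := by
        refine Finset.sum_le_card_nsmul _ _ _ fun a ha => ?_
        obtain ⟨hb, hab⟩ := nontrivialDivisors_div_mem ha
        rw [mem_nontrivialDivisors] at ha hb
        exact numOrderedFactorizations_le_three (by nlinarith) ha.2.1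
      rw [smul_eq_mul] at h
      exact_mod_cast (by omega : _ ≤ 3 ^ 3)
  · have h4 := hlog 4 (by omega)
    have h1 := numOrderedFactorizations_le_sq n hn
    rw [numOrderedFactorizations_eq] at h1
    push_cast at h1 h4 ⊢
    calc _ ≤ (n : ℝ) ^ 2 := by linarith
      _ = ((2 : ℝ) ^ (Real.logb 2 n)) ^ 2 := by rw [Real.rpow_logb (by norm_num) (by norm_num) hpos]
      _ = (4 : ℝ) ^ (Real.logb 2 n) := by
        rw [sq, ← Real.mul_rpow (by norm_num) (by norm_num)]; norm_num
      _ ≤ _ := Real.rpow_le_rpow (by norm_num) h4 (by linarith)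

/-! ### The recursion and the bounds -/

namespace PlaneAut
variable {K : Type u} [Field K] [Finite K]

theorem card_bidegree_of_dvd {a n : ℕ} (han : a ≤ n) (hn : 2 ≤ n) (h : a ∣ n) :
    (Nat.card (Bidegree K a n) : ℝ) = ((Nat.card K : ℝ) - 1) * Nat.card (Bounded K a n) := by
  obtain ⟨k, rfl⟩ := h
  have h1 := card_bidegree_add (K := K) a (a * k)
  rw [card_bounded_succ_of_dvd han hn] at h1
  have h2 : ((Nat.card (Bidegree K a (a * k)) + Nat.card (Bounded K a (a * k)) : ℕ) : ℝ) =
    ((Nat.card K * Nat.card (Bounded K a (a * k)) : ℕ) : ℝ) := by rw [h1]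
  push_cast at h2
  linarith

theorem card_bidegree_of_not_dvd {a n : ℕ} (han : a ≤ n) (hn : 2 ≤ n) (h : ¬ a ∣ n) :
    Nat.card (Bidegree K a n) = 0 := by
  have h1 := card_bidegree_add (K := K) a n
  rw [card_bounded_succ_of_not_dvd han hn h] at h1
  omega

/-- The first summand comes from `deg f = 1`, where `f` and the reduced `g` are affine; the others
come from `deg f = a` with `a` a nontrivial divisor of `n`. -/
theorem card_bounded_self_recursion {n : ℕ} (hn : 2 ≤ n) :
    (Nat.card (Bounded K n n) : ℝ) =
      ((Nat.card K : ℝ) - 1) ^ 3 * (Nat.card K + 1) * (Nat.card K : ℝ) ^ (n + 1) +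
      ∑ a ∈ nontrivialDivisors n,
        ((Nat.card K : ℝ) - 1) * (Nat.card K : ℝ) ^ (n / a - 1) * Nat.card (Bounded K a a) := by
  have hq : 2 ≤ Nat.card K := Finite.one_lt_card
  set q := Nat.card K with hqdef
  have h1 : (Nat.card (Bidegree K 1 n) : ℝ) =
      ((q : ℝ) - 1) ^ 3 * (q + 1) * (q : ℝ) ^ (n + 1) := by
    rw [card_bidegree_of_dvd (by omega) hn (one_dvd n),
      card_bounded (t := 2) (by norm_num) le_rfl n hn one_pos, card_bounded_one_two, ← hqdef]
    obtain ⟨m, rfl⟩ := Nat.exists_eq_add_of_le hn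
    rw [show (2 + m - 1) / 1 - (2 - 1) / 1 = m by omega]
    have e1 : 1 ≤ q ^ 2 := Nat.one_le_pow _ _ (by omega)
    have e2 : q ≤ q ^ 2 := by nlinarith
    push_cast [Nat.cast_sub e1, Nat.cast_sub e2]
    ring
  have h2 : ∀ a ∈ nontrivialDivisors n, (Nat.card (Bidegree K a n) : ℝ) =
      ((q : ℝ) - 1) * (q : ℝ) ^ (n / a - 1) * Nat.card (Bounded K a a) := by
    intro a ha
    rw [mem_nontrivialDivisors] at ha
    rw [card_bidegree_of_dvd ha.1.le hn ha.2.2,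
      card_bounded (t := a) le_rfl ha.2.1 n ha.1.le (by omega), ← hqdef]
    have e : (n - 1) / a - (a - 1) / a = n / a - 1 := by
      obtain ⟨k, rfl⟩ := ha.2.2
      obtain ⟨l, rfl⟩ : ∃ l, k = l + 1 := ⟨k - 1, by
        have : k ≠ 0 := by rintro rfl; omega
        omega⟩
      rw [Nat.mul_div_cancel_left _ (by omega), Nat.div_eq_of_lt (show a - 1 < a by omega),
        show a * (l + 1) - 1 = a * l + (a - 1) by rw [mul_add]; omega,
        Nat.mul_add_div (by omega), Nat.div_eq_of_lt (show a - 1 < a by omega)]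
      omega
    rw [e]
    push_cast
    ring
  rw [card_bounded_self, ← h1, ← Finset.sum_congr rfl h2]
  push_cast
  have hsub : insert 1 (nontrivialDivisors n) ⊆ Finset.range n := by
    intro a ha
    rw [Finset.mem_insert, mem_nontrivialDivisors] at ha
    rw [Finset.mem_range]
    omega
  rw [← Finset.sum_subset hsub, Finset.sum_insert]
  · rw [mem_nontrivialDivisors]; omega
  · intro a ha hna
    rw [Finset.mem_range] at ha
    rw [Finset.mem_insert, mem_nontrivialDivisors] at hna
    rw [card_bidegree_of_not_dvd ha.le hn, Nat.cast_zero]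
    intro hdvd
    have : a ≠ 0 := by rintro rfl; rw [zero_dvd_iff] at hdvd; omega
    omega

theorem card_bounded_self_le {n : ℕ} (hn : 2 ≤ n) :
    (Nat.card (Bounded K n n) : ℝ) ≤ numOrderedFactorizations n * (Nat.card K : ℝ) ^ (n + 5) := by
  have hq : 2 ≤ Nat.card K := Finite.one_lt_card
  have hq' : (2 : ℝ) ≤ Nat.card K := by exact_mod_cast hq
  induction n using Nat.strong_induction_on with
  | _ n ih =>
    rw [card_bounded_self_recursion hn, numOrderedFactorizations_eq]
    set q : ℝ := ((Nat.card K : ℕ) : ℝ)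
    push_cast
    rw [add_mul, one_mul, Finset.sum_mul]
    refine add_le_add ?_ (Finset.sum_le_sum fun a ha => ?_)
    · have h1 : (q - 1) ^ 3 * (q + 1) ≤ q ^ 4 := by
        have e1 : (q - 1) * (q + 1) ≤ q ^ 2 := by nlinarith
        have e2 : (q - 1) ^ 2 ≤ q ^ 2 := by nlinarith
        calc (q - 1) ^ 3 * (q + 1) = (q - 1) ^ 2 * ((q - 1) * (q + 1)) := by ring
          _ ≤ q ^ 2 * q ^ 2 := mul_le_mul e2 e1 (by nlinarith) (by positivity)
          _ = q ^ 4 := by ring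
      calc _ ≤ q ^ 4 * q ^ (n + 1) := mul_le_mul_of_nonneg_right h1 (by positivity)
        _ = q ^ (n + 5) := by ring
    · obtain ⟨hb, hab⟩ := nontrivialDivisors_div_mem ha
      rw [mem_nontrivialDivisors] at ha hb
      obtain ⟨b, hb'⟩ : ∃ b, n / a = b + 1 := ⟨n / a - 1, by omega⟩
      rw [hb'] at hab hb ⊢
      rw [Nat.add_sub_cancel]
      calc _ ≤ q * q ^ b * (numOrderedFactorizations a * q ^ (a + 5)) := by
            apply mul_le_mul _ (ih a ha.1 ha.2.1) (by positivity) (by positivity)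
            exact mul_le_mul_of_nonneg_right (by linarith) (by positivity)
        _ = numOrderedFactorizations a * q ^ (a + (b + 1) + 5) := by ring
        _ ≤ _ := by
            refine mul_le_mul_of_nonneg_left (pow_le_pow_right₀ (by linarith) ?_) (by positivity)
            nlinarith

/-- A divisor `a` with cofactor `b` contributes at most a multiple of `q ^ (a + b + 6)` to the
error, and `a + b ≤ n / 2 + 2` because `(a - 2) (b - 2) ≥ 0`. -/
theorem numPlaneAut_sub_bounds {n : ℕ} (hn : 2 ≤ n) :
    0 ≤ (numPlaneAut K n : ℝ) -
      ((Nat.card K : ℝ) - 1) ^ 3 * ((Nat.card K : ℝ) + 1) ^ 2 * (Nat.card K : ℝ) ^ (n + 1) ∧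
    (numPlaneAut K n : ℝ) -
      ((Nat.card K : ℝ) - 1) ^ 3 * ((Nat.card K : ℝ) + 1) ^ 2 * (Nat.card K : ℝ) ^ (n + 1) ≤
      ((∑ a ∈ nontrivialDivisors n, numOrderedFactorizations a : ℕ) : ℝ) *
        (Nat.card K : ℝ) ^ ((n : ℝ) / 2 + 8) := by
  have hq : 2 ≤ Nat.card K := Finite.one_lt_card
  have hq' : (2 : ℝ) ≤ Nat.card K := by exact_mod_cast hq
  rw [numPlaneAut_eq hn, Nat.cast_mul, card_bounded_self_recursion hn]
  set q : ℝ := ((Nat.card K : ℕ) : ℝ)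
  set s := ∑ a ∈ nontrivialDivisors n, (q - 1) * q ^ (n / a - 1) * (Nat.card (Bounded K a a) : ℝ)
    with hs
  have hc : ((Nat.card K + 1 : ℕ) : ℝ) = q + 1 := by push_cast; rfl
  have heq : ((Nat.card K + 1 : ℕ) : ℝ) * ((q - 1) ^ 3 * (q + 1) * q ^ (n + 1) + s) -
      (q - 1) ^ 3 * (q + 1) ^ 2 * q ^ (n + 1) = (q + 1) * s := by rw [hc]; ring
  rw [heq]
  constructor
  · refine mul_nonneg (by linarith) (Finset.sum_nonneg fun a _ => ?_)
    exact mul_nonneg (mul_nonneg (by linarith) (by positivity)) (by positivity)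
  · push_cast
    rw [hs, Finset.mul_sum, Finset.sum_mul]
    refine Finset.sum_le_sum fun a ha => ?_
    obtain ⟨hb, hab⟩ := nontrivialDivisors_div_mem ha
    rw [mem_nontrivialDivisors] at ha hb
    obtain ⟨b, hb'⟩ : ∃ b, n / a = b + 1 := ⟨n / a - 1, by omega⟩
    rw [hb'] at hab hb ⊢
    rw [Nat.add_sub_cancel]
    calc (q + 1) * ((q - 1) * q ^ b * (Nat.card (Bounded K a a) : ℝ))
        = ((q + 1) * (q - 1)) * q ^ b * (Nat.card (Bounded K a a) : ℝ) := by ring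
      _ ≤ q ^ 2 * q ^ b * (numOrderedFactorizations a * q ^ (a + 5)) := by
          apply mul_le_mul _ (card_bounded_self_le ha.2.1) (by positivity) (by positivity)
          exact mul_le_mul_of_nonneg_right (by nlinarith) (by positivity)
      _ = numOrderedFactorizations a * q ^ (((a + (b + 1) + 6 : ℕ) : ℝ)) := by
          rw [Real.rpow_natCast]; ring
      _ ≤ _ := by
          refine mul_le_mul_of_nonneg_left (Real.rpow_le_rpow_of_exponent_le (by linarith) ?_)
            (by positivity)
          have h1 : (n : ℝ) = a * (b + 1) := by rw [← hab]; push_cast; ring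
          have h2 : (2 : ℝ) ≤ a := by exact_mod_cast ha.2.1
          have h3 : (2 : ℝ) ≤ b + 1 := by exact_mod_cast hb.2.1
          rw [h1]
          push_cast
          nlinarith

end PlaneAut

theorem theorem2p3 {F : Type*} [Field F] [Fintype F] (q : ℕ) (hq : Fintype.card F = q) :
    (∀ n : ℕ, 2 ≤ n →
      ((q : ℝ) - 1) ^ 3 * ((q : ℝ) + 1) ^ 2 * (q : ℝ) ^ (n + 1) ≤ (numPlaneAut F n : ℝ) ∧
      (numPlaneAut F n : ℝ) ≤
        ((q : ℝ) - 1) ^ 3 * ((q : ℝ) + 1) ^ 2 * (q : ℝ) ^ (n + 1) +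
          (Real.logb 2 (n : ℝ)) ^ (Real.logb 2 (n : ℝ)) * (q : ℝ) ^ ((n : ℝ) / 2 + 8)) ∧
    (∀ ε : ℝ, 0 < ε →
      Asymptotics.IsBigO Filter.atTop
        (fun n : ℕ => (numPlaneAut F n : ℝ) -
          ((q : ℝ) - 1) ^ 3 * ((q : ℝ) + 1) ^ 2 * (q : ℝ) ^ (n + 1))
        (fun n : ℕ => (q : ℝ) ^ ((n : ℝ) * (1 / 2 + ε)))) := by
  have hq2 : 2 ≤ q := hq ▸ Fintype.one_lt_card
  have hqpos : (0 : ℝ) < q := by positivity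
  have hq1 : (1 : ℝ) < q := by exact_mod_cast hq2
  have hbounds := fun (n : ℕ) (hn : 2 ≤ n) => PlaneAut.numPlaneAut_sub_bounds (K := F) hn
  rw [Nat.card_eq_fintype_card, hq] at hbounds
  refine ⟨fun n hn => ?_, fun ε hε => ?_⟩
  · obtain ⟨h1, h2⟩ := hbounds n hn
    refine ⟨by linarith, ?_⟩
    have h3 := mul_le_mul_of_nonneg_right (sum_numOrderedFactorizations_le n hn)
      (Real.rpow_nonneg hqpos.le ((n : ℝ) / 2 + 8))
    linarith
  · have h1 : Asymptotics.IsBigO Filter.atTop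
        (fun n : ℕ => (numPlaneAut F n : ℝ) -
          ((q : ℝ) - 1) ^ 3 * ((q : ℝ) + 1) ^ 2 * (q : ℝ) ^ (n + 1))
        (fun n : ℕ => (n : ℝ) ^ 2 * (q : ℝ) ^ ((n : ℝ) / 2 + 8)) := by
      refine Asymptotics.IsBigO.of_bound 1 ?_
      filter_upwards [Filter.eventually_ge_atTop 2] with n hn
      obtain ⟨h1, h2⟩ := hbounds n hn
      rw [Real.norm_of_nonneg h1, Real.norm_of_nonneg (by positivity), one_mul]
      refine h2.trans (mul_le_mul_of_nonneg_right ?_ (by positivity))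
      have h3 := numOrderedFactorizations_le_sq n hn
      rw [numOrderedFactorizations_eq] at h3
      push_cast at h3 ⊢
      linarith
    have h2 : Asymptotics.IsBigO Filter.atTop (fun n : ℕ => (n : ℝ) ^ 2)
        (fun n : ℕ => ((q : ℝ) ^ ε) ^ n) :=
      (isLittleO_pow_const_const_pow_of_one_lt 2 (Real.one_lt_rpow hq1 hε)).isBigO
    have h3 : Asymptotics.IsBigO Filter.atTop (fun n : ℕ => (q : ℝ) ^ ((n : ℝ) / 2 + 8))
        (fun n : ℕ => (q : ℝ) ^ ((n : ℝ) / 2)) := by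
      refine Asymptotics.IsBigO.of_bound ((q : ℝ) ^ (8 : ℝ))
        (Filter.Eventually.of_forall fun n => ?_)
      rw [Real.norm_of_nonneg (by positivity), Real.norm_of_nonneg (by positivity),
        Real.rpow_add hqpos, mul_comm]
    refine (h1.trans (h2.mul h3)).trans (Asymptotics.isBigO_of_le _ fun n => le_of_eq ?_)
    rw [← Real.rpow_natCast, ← Real.rpow_mul hqpos.le, ← Real.rpow_add hqpos]
    congr 2
    ring
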